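/- Let $n$ be a dimension. For real $n\times n$ matrices $P=P^T$, $Q=Q^T$ and $L$ with $\det L\neq 0$ put $W(x,x')=\frac12 Px\cdot x-Lx\cdot x'+\frac12 Qx'\cdot x'$, and let $$S_W=\begin{pmatrix}L^{-1}Q & L^{-1}\\ PL^{-1}Q-L^T & PL^{-1}\end{pmatrix}\in Sp(n,\mathbb{R}).$$ For every $m\in\mathbb{Z}$ with $m\pi\equiv\arg\det L \pmod{2\pi}$ let $\widehat S_{W,m}$ be the unitary operator of $L^2(\mathbb{R}^n)$ given on $\psi\in\mathcal S(\mathbb{R}^n)$ by $$\widehat S_{W,m}\psi(x)=\frac{i^m\sqrt{|\det L|}}{(2\pi)^{n/2}e^{i\pi n/4}}\int_{\mathbb{R}^n}e^{iW(x,x')}\psi(x')\,dx'.$$ The metaplectic group $Mp(n,\mathbb{R})$ is the group of unitary operators of $L^2(\mathbb{R}^n)$ generated by the operators $\widehat S_{W,m}$, and $\pi:Mp(n,\mathbb{R})\to Sp(n,\mathbb{R})$ is the group homomorphism with $\pi(\widehat S_{W,m})=S_W$. For $S\in Sp(n,\mathbb{R})$ let $\lambda_1(S)\geq\dots\geq\lambda_n(S)\geq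 1$ be its $n$ largest singular values, counted with multiplicity (its singular values are $\lambda_1\geq\dots\geq\lambda_n\geq\lambda_n^{-1}\geq\dots\geq\lambda_1^{-1}$). Fix a window $\varphi\in\mathcal S(\mathbb{R}^n)\setminus\{0\}$, let $\varphi_z(y)=e^{i\xi\cdot y}\varphi(y-x)$ for $z=(x,\xi)\in\mathbb{R}^n\times\mathbb{R}^n$, and put $$\|f\|_{M^1}=\int_{\mathbb{R}^{2n}}|\langle f,\varphi_z\rangle|\,dz,\qquad \|f\|_{M^\infty}=\operatorname*{ess\,sup}_{z\in\mathbb{R}^{2n}}|\langle f,\varphi_z\rangle|,$$ where $\langle f,g\rangle=\int_{\mathbb{R}^n} f\,\overline{g}$. **Theorem 1.1 (Dispersive estimate).** There is a constant $C>0$, depending only on $n$ and $\varphi$, such that for every $\widehat S\in Mp(n,\mathbb{R})$, with projection $S=\pi(\widehat S)$, and every $\psi\in\mathcal S(\mathbb{R}^n)$, $$\|\widehat S\psi\|_{M^\infty}\leq C\,\bigl(\lambda_1(S)\cdots\lambda_n(S)\bigr)^{-1/2}\,\|\psi\|_{M^1}.$$ -/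

import Mathlib

open MeasureTheory Matrix
open scoped SchwartzMap ENNReal ComplexConjugate

noncomputable section

namespace Metaplectic

/-- Euclidean space `ℝⁿ`, with its Lebesgue measure `volume`. -/
abbrev E (n : ℕ) : Type := EuclideanSpace ℝ (Fin n)

/-- The Hilbert space `L²(ℝⁿ)` of complex-valued functions. -/
abbrev L2 (n : ℕ) : Type := Lp ℂ 2 (volume : Measure (E n))

/-- The real symplectic group `Sp(n,ℝ)` of `2n × 2n` matrices (in `n × n` blocks). -/
abbrev Sp (n : ℕ) : Type := symplecticGroup (Fin n) ℝ

/-- The data of a quadratic form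
`W(x,x') = ½ Px·x - Lx·x' + ½ Qx'·x'` with `P = Pᵀ`, `Q = Qᵀ` and `det L ≠ 0`. -/
structure GeneratingFunction (n : ℕ) where
  P : Matrix (Fin n) (Fin n) ℝ
  L : Matrix (Fin n) (Fin n) ℝ
  Q : Matrix (Fin n) (Fin n) ℝ
  P_symm : Pᵀ = P
  Q_symm : Qᵀ = Q
  det_L_ne_zero : L.det ≠ 0

namespace GeneratingFunction

variable {n : ℕ}

/-- The value `W(x,x') = ½ Px·x - Lx·x' + ½ Qx'·x'`. -/
def eval (W : GeneratingFunction n) (x x' : E n) : ℝ :=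
  1 / 2 * ((W.P *ᵥ x.ofLp) ⬝ᵥ x.ofLp) - (W.L *ᵥ x.ofLp) ⬝ᵥ x'.ofLp
    + 1 / 2 * ((W.Q *ᵥ x'.ofLp) ⬝ᵥ x'.ofLp)

/-- The block matrix of the free symplectic matrix generated by `W`. -/
def freeMatrix (W : GeneratingFunction n) : Matrix (Fin n ⊕ Fin n) (Fin n ⊕ Fin n) ℝ :=
  fromBlocks (W.L⁻¹ * W.Q) W.L⁻¹ (W.P * W.L⁻¹ * W.Q - W.Lᵀ) (W.P * W.L⁻¹)

theorem freeMatrix_mem (W : GeneratingFunction n) :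
    W.freeMatrix ∈ symplecticGroup (Fin n) ℝ := by
  have hL : IsUnit W.L.det := isUnit_iff_ne_zero.mpr W.det_L_ne_zero
  have hLt : IsUnit (W.Lᵀ).det := by rwa [det_transpose]
  have h1 : W.L * W.L⁻¹ = 1 := mul_nonsing_inv _ hL
  have h2 : (W.Lᵀ)⁻¹ * W.Lᵀ = 1 := nonsing_inv_mul _ hLt
  rw [SymplecticGroup.mem_iff', freeMatrix, J, fromBlocks_transpose, fromBlocks_multiply,
    fromBlocks_multiply]
  simp only [transpose_sub, transpose_mul, transpose_transpose, transpose_nonsing_inv,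
    W.P_symm, W.Q_symm, Matrix.mul_zero, Matrix.mul_one, zero_add, add_zero, Matrix.mul_neg,
    Matrix.neg_mul, Matrix.sub_mul, Matrix.mul_sub, Matrix.mul_assoc, h1, h2]
  simp only [← Matrix.mul_assoc W.L, h1, Matrix.one_mul]
  congr 1 <;> abel

/-- The free symplectic matrix `S_W` generated by `W`. -/
def freeSymplectic (W : GeneratingFunction n) : Sp n := ⟨W.freeMatrix, W.freeMatrix_mem⟩

/-- `m` is an admissible Maslov index for `W`: `m π ≡ arg (det L)` modulo `2π`. -/
def IsMaslovIndex (W : GeneratingFunction n) (m : ℤ) : Prop :=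
  ∃ k : ℤ, (m : ℝ) * Real.pi = Complex.arg ((W.L.det : ℝ) : ℂ) + 2 * Real.pi * k

/-- The quadratic Fourier integral
`(2πi)^{-n/2} i^m √|det L| ∫ e^{i W(x,x')} ψ(x') dx'`, where
`(2πi)^{n/2} = (2π)^{n/2} e^{iπn/4}`. -/
def fourierIntegral (W : GeneratingFunction n) (m : ℤ) (ψ : 𝓢(E n, ℂ)) (x : E n) : ℂ :=
  1 / ((((2 * Real.pi) ^ ((n : ℝ) / 2) : ℝ) : ℂ) * Complex.exp (Complex.I * Real.pi * n / 4))
    * (Complex.I ^ m * (Real.sqrt |W.L.det| : ℂ))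
    * ∫ x' : E n, Complex.exp (Complex.I * (W.eval x x' : ℂ)) * ψ x'

/-- The unitary operator `U` of `L²(ℝⁿ)` is the quadratic Fourier transform `Ŝ_{W,m}`:
on Schwartz functions, which are dense in `L²`, it is given by the quadratic Fourier integral. -/
def IsQuadraticFourierTransform (W : GeneratingFunction n) (m : ℤ) (U : L2 n ≃ₗᵢ[ℂ] L2 n) :
    Prop :=
  W.IsMaslovIndex m ∧
    ∀ ψ : 𝓢(E n, ℂ), (U (ψ.toLp 2 volume) : E n → ℂ) =ᵐ[volume] W.fourierIntegral m ψ

end GeneratingFunction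

/-- The metaplectic group `Mp(n,ℝ)`: the subgroup of the unitary group of `L²(ℝⁿ)` generated by
the quadratic Fourier transforms. -/
def Mp (n : ℕ) : Subgroup (L2 n ≃ₗᵢ[ℂ] L2 n) :=
  Subgroup.closure {U | ∃ (W : GeneratingFunction n) (m : ℤ), W.IsQuadraticFourierTransform m U}

/-- The graph of the projection `π : Mp(n,ℝ) → Sp(n,ℝ)`, the group homomorphism that extends
`Ŝ_{W,m} ↦ S_W`: as a subgroup of the product it is generated by the pairs `(Ŝ_{W,m}, S_W)`. -/
def projectionGraph (n : ℕ) : Subgroup ((L2 n ≃ₗᵢ[ℂ] L2 n) × Sp n) :=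
  Subgroup.closure {p | ∃ (W : GeneratingFunction n) (m : ℤ),
    W.IsQuadraticFourierTransform m p.1 ∧ p.2 = W.freeSymplectic}

/-- `S = π(Ŝ)`. -/
def IsProjection {n : ℕ} (Shat : L2 n ≃ₗᵢ[ℂ] L2 n) (S : Sp n) : Prop :=
  (Shat, S) ∈ projectionGraph n

/-- The metaplectic operators are exactly the unitary operators that have a projection. -/
theorem mem_Mp_iff {n : ℕ} (Shat : L2 n ≃ₗᵢ[ℂ] L2 n) :
    Shat ∈ Mp n ↔ ∃ S : Sp n, IsProjection Shat S := by
  have h : (projectionGraph n).map (MonoidHom.fst (L2 n ≃ₗᵢ[ℂ] L2 n) (Sp n)) = Mp n := by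
    rw [projectionGraph, MonoidHom.map_closure, Mp]
    congr 1
    ext U
    constructor
    · rintro ⟨p, ⟨W, m, hW, -⟩, rfl⟩
      exact ⟨W, m, hW⟩
    · rintro ⟨W, m, hW⟩
      exact ⟨(U, W.freeSymplectic), ⟨W, m, hW, rfl⟩, rfl⟩
  rw [← h]
  constructor
  · rintro ⟨⟨U, S⟩, hp, rfl⟩
    exact ⟨S, hp⟩
  · rintro ⟨S, hS⟩
    exact ⟨(Shat, S), hS, rfl⟩

/-- The singular values of `S`, with multiplicity, in decreasing order, indexed from `0`. For
symplectic `S` they are `λ₁ ≥ … ≥ λₙ ≥ λₙ⁻¹ ≥ … ≥ λ₁⁻¹`, so that `λ₁, …, λₙ` (the singular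
values `≥ 1`) are those with index `< n`. -/
def singularValue {n : ℕ} (S : Sp n) (i : ℕ) : ℝ :=
  (Matrix.toEuclideanLin (S : Matrix (Fin n ⊕ Fin n) (Fin n ⊕ Fin n) ℝ)).singularValues i

/-- The time-frequency shift `φ_z(y) = e^{iξ·y} φ(y - x)`, for `z = (x,ξ)`. -/
def timeFrequencyShift {n : ℕ} (φ : E n → ℂ) (z : E n × E n) (y : E n) : ℂ :=
  Complex.exp (Complex.I * ((inner ℝ z.2 y : ℝ) : ℂ)) * φ (y - z.1)

/-- The modulation space norm `‖f‖_{M^p} = ‖z ↦ ⟨f, φ_z⟩‖_{L^p(ℝ²ⁿ)}` with window `φ`, for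
functions `f` whose products with Schwartz functions are integrable (such as `f ∈ L²`); the
pairing is linear in `f`. The value is in `[0,∞]`. -/
def modulationNorm {n : ℕ} (φ : 𝓢(E n, ℂ)) (p : ℝ≥0∞) (f : E n → ℂ) : ℝ≥0∞ :=
  eLpNorm (fun z : E n × E n => ∫ y : E n, f y * conj (timeFrequencyShift φ z y)) p volume

end Metaplectic

end

/-!
A metaplectic operator `U` maps a Gaussian `e^{-½ My·y + b·y}` to a multiple of another one, with
`M` moved in the Siegel half-space by the symplectic matrix `S = π(U)`. As `U` preserves the `L²`
norm, the overlap of `U` applied to a standard Gaussian (`M = 1`) with a second standard Gaussian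
is bounded, up to a power of `2` and the norms, by `(det (Re M'))^{1/4} |det (M' + 1)|^{-1/2}` for
the moved matrix `M'`. The invariance of `⟨v, iJv⟩` under `S` turns this into
`det (1 + SᵀS)^{-1/4}`, which is at most `(λ₁ ⋯ λₙ)^{-1/2}`. Time-frequency shifts of Gaussians
are Gaussians, hence all wave packets obey the bound. Finally Moyal's identity gives the pairing
`|⟨u, f⟩| ≤ C ‖u‖_{M^∞} ‖f‖_{M¹}`, by which the bound passes to wave packets of an arbitrary
window, and from there to all `f`.
-/

noncomputable section

namespace Metaplectic

section Complexification

variable {l m n o : Type*}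

/-- The complexification of a real matrix. -/
def toC (K : Matrix m n ℝ) : Matrix m n ℂ := K.map Complex.ofReal

/-- The complexification of a real vector. -/
def vecC (v : n → ℝ) : n → ℂ := fun i => (v i : ℂ)

@[simp] theorem toC_apply (K : Matrix m n ℝ) (i : m) (j : n) : toC K i j = (K i j : ℂ) := rfl

@[simp] theorem vecC_apply (v : n → ℝ) (i : n) : vecC v i = (v i : ℂ) := rfl

theorem toC_mul [Fintype m] (A : Matrix l m ℝ) (B : Matrix m n ℝ) :
    toC (A * B) = toC A * toC B :=
  Matrix.map_mul (f := Complex.ofRealHom)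

theorem toC_transpose (A : Matrix m n ℝ) : toC Aᵀ = (toC A)ᵀ := rfl

theorem toC_conjTranspose (A : Matrix m n ℝ) : (toC A)ᴴ = (toC A)ᵀ := by
  ext i j; simp

@[simp] theorem toC_one [DecidableEq n] : toC (1 : Matrix n n ℝ) = 1 :=
  Matrix.map_one _ Complex.ofReal_zero Complex.ofReal_one

theorem toC_add (A B : Matrix m n ℝ) : toC (A + B) = toC A + toC B := by
  ext i j; simp

theorem toC_sub (A B : Matrix m n ℝ) : toC (A - B) = toC A - toC B := by
  ext i j; simp

theorem toC_neg (A : Matrix m n ℝ) : toC (-A) = -toC A := by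
  ext i j; simp

theorem toC_fromBlocks (A : Matrix n l ℝ) (B : Matrix n m ℝ) (C : Matrix o l ℝ)
    (D : Matrix o m ℝ) :
    toC (fromBlocks A B C D) = fromBlocks (toC A) (toC B) (toC C) (toC D) :=
  fromBlocks_map A B C D _

@[simp] theorem star_vecC (v : n → ℝ) : star (vecC v) = vecC v := by
  ext i; simp

theorem re_add_I_smul_im (y : n → ℂ) :
    vecC (Complex.re ∘ y) + Complex.I • vecC (Complex.im ∘ y) = y := by
  ext i; simp [mul_comm Complex.I, Complex.re_add_im]

variable [Fintype n]

theorem toC_mulVec (A : Matrix m n ℝ) (v : n → ℝ) : toC A *ᵥ vecC v = vecC (A *ᵥ v) := by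
  ext i; simp [mulVec, dotProduct]

theorem vecC_dotProduct (v w : n → ℝ) : vecC v ⬝ᵥ vecC w = ((v ⬝ᵥ w : ℝ) : ℂ) := by
  simp [dotProduct]

theorem re_vecC_dotProduct (v : n → ℝ) (w : n → ℂ) :
    (vecC v ⬝ᵥ w).re = v ⬝ᵥ (Complex.re ∘ w) := by
  simp [dotProduct]

variable [DecidableEq n]

theorem det_toC (A : Matrix n n ℝ) : (toC A).det = (A.det : ℂ) :=
  (Complex.ofRealHom.map_det A).symm

theorem isUnit_det_toC {A : Matrix n n ℝ} (hA : A.det ≠ 0) : IsUnit (toC A).det := by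
  rw [det_toC, isUnit_iff_ne_zero]; exact_mod_cast hA

theorem toC_inv {A : Matrix n n ℝ} (hA : A.det ≠ 0) : toC A⁻¹ = (toC A)⁻¹ := by
  refine (Matrix.inv_eq_left_inv ?_).symm
  rw [← toC_mul, Matrix.nonsing_inv_mul _ (isUnit_iff_ne_zero.mpr hA), toC_one]

end Complexification

section RealPart

variable {n : Type*}

/-- The entrywise real part of a complex matrix. -/
def rePart (M : Matrix n n ℂ) : Matrix n n ℝ := M.map Complex.re

/-- The entrywise imaginary part of a complex matrix. -/
def imPart (M : Matrix n n ℂ) : Matrix n n ℝ := M.map Complex.im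

theorem rePart_add_imPart (M : Matrix n n ℂ) :
    toC (rePart M) + Complex.I • toC (imPart M) = M := by
  ext i j
  simp [rePart, imPart, mul_comm Complex.I, Complex.re_add_im]

theorem rePart_add (M N : Matrix n n ℂ) : rePart (M + N) = rePart M + rePart N := by
  ext i j; simp [rePart]

@[simp] theorem rePart_one [DecidableEq n] : rePart (1 : Matrix n n ℂ) = 1 :=
  Matrix.map_one _ Complex.zero_re Complex.one_re

theorem add_map_conj (M : Matrix n n ℂ) :
    M + M.map (starRingEnd ℂ) = (2 : ℂ) • toC (rePart M) := by
  ext i j; simp [rePart, Complex.add_conj]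

variable [Fintype n]

theorem re_vecC_dotProduct_mulVec_vecC (M : Matrix n n ℂ) (v : n → ℝ) :
    (vecC v ⬝ᵥ M *ᵥ vecC v).re = v ⬝ᵥ rePart M *ᵥ v := by
  rw [re_vecC_dotProduct]
  congr 1
  ext i
  simp [mulVec, dotProduct, rePart]

theorem re_star_dotProduct_mulVec {M : Matrix n n ℂ} (hM : Mᵀ = M) (y : n → ℂ) :
    (star y ⬝ᵥ M *ᵥ y).re
      = (Complex.re ∘ y) ⬝ᵥ rePart M *ᵥ (Complex.re ∘ y)
        + (Complex.im ∘ y) ⬝ᵥ rePart M *ᵥ (Complex.im ∘ y) := by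
  set p := vecC (Complex.re ∘ y)
  set q := vecC (Complex.im ∘ y)
  have hcross : q ⬝ᵥ M *ᵥ p = p ⬝ᵥ M *ᵥ q := by
    rw [dotProduct_mulVec, ← mulVec_transpose, hM, dotProduct_comm]
  have hI : star Complex.I = -Complex.I := Complex.conj_I
  have hsum : star y ⬝ᵥ M *ᵥ y = p ⬝ᵥ M *ᵥ p + q ⬝ᵥ M *ᵥ q := by
    rw [← re_add_I_smul_im y]
    simp only [star_add, star_smul, star_vecC, mulVec_add, mulVec_smul, add_dotProduct,
      dotProduct_add, smul_dotProduct, dotProduct_smul, smul_eq_mul, hI]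
    linear_combination (-(q ⬝ᵥ M *ᵥ q)) * Complex.I_mul_I - Complex.I * hcross
  rw [hsum, Complex.add_re, re_vecC_dotProduct_mulVec_vecC, re_vecC_dotProduct_mulVec_vecC]

end RealPart

section Diagonalization

variable {n : Type*} [Fintype n] [DecidableEq n]

theorem exists_orthogonal_diagonal {A : Matrix n n ℝ} (hA : Aᵀ = A) :
    ∃ (O : Matrix n n ℝ) (d : n → ℝ), Oᵀ * O = 1 ∧ A = Oᵀ * diagonal d * O := by
  have hA' : A.IsHermitian := by rwa [IsHermitian, conjTranspose_eq_transpose_of_trivial]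
  refine ⟨(hA'.eigenvectorUnitary : Matrix n n ℝ)ᵀ, hA'.eigenvalues, ?_, ?_⟩
  · have := Unitary.coe_mul_star_self hA'.eigenvectorUnitary
    simpa [star_eq_conjTranspose, conjTranspose_eq_transpose_of_trivial] using this
  · conv_lhs => rw [hA'.spectral_theorem]
    rw [Unitary.conjStarAlgAut_apply]
    simp only [star_eq_conjTranspose, conjTranspose_eq_transpose_of_trivial, transpose_transpose]
    rfl

open scoped MatrixOrder in
theorem exists_eq_transpose_mul_self {R : Matrix n n ℝ} (hR : R.PosDef) :
    ∃ K : Matrix n n ℝ, IsUnit K.det ∧ R = Kᵀ * K := by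
  have hsq : CFC.sqrt R * CFC.sqrt R = R := CFC.sqrt_mul_sqrt_self R hR.posSemidef.nonneg
  have hsymm : (CFC.sqrt R)ᵀ = CFC.sqrt R := (CFC.sqrt_nonneg R).isSelfAdjoint
  refine ⟨CFC.sqrt R, isUnit_of_mul_isUnit_left (y := (CFC.sqrt R).det) ?_, by rw [hsymm, hsq]⟩
  rw [← det_mul, hsq]
  exact isUnit_iff_ne_zero.mpr hR.det_pos.ne'

/-- Diagonalize `K⁻ᵀ T K⁻¹` by an orthogonal matrix, where `R = Kᵀ K`. -/
theorem exists_simultaneous_diagonal {R T : Matrix n n ℝ} (hR : R.PosDef) (hT : Tᵀ = T) :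
    ∃ (K : Matrix n n ℝ) (d : n → ℝ), K.det ≠ 0 ∧ R = Kᵀ * K ∧ T = Kᵀ * diagonal d * K := by
  obtain ⟨K, hK, hRK⟩ := exists_eq_transpose_mul_self hR
  obtain ⟨O, d, hO, hTO⟩ := exists_orthogonal_diagonal (A := Kᵀ⁻¹ * T * K⁻¹) (by
    rw [transpose_mul, transpose_mul, hT, transpose_nonsing_inv, transpose_nonsing_inv,
      transpose_transpose, Matrix.mul_assoc])
  have hOdet : IsUnit O.det :=
    isUnit_of_mul_isUnit_right (x := Oᵀ.det) (by rw [← det_mul, hO, det_one]; exact isUnit_one)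
  have hTK : Kᵀ * (Kᵀ⁻¹ * T * K⁻¹) * K = T := by
    rw [Matrix.mul_assoc, nonsing_inv_mul_cancel_right _ _ hK,
      mul_nonsing_inv_cancel_left _ _ (by rwa [det_transpose])]
  refine ⟨O * K, d, ?_, ?_, ?_⟩
  · rw [det_mul]
    exact (hOdet.mul hK).ne_zero
  · rw [transpose_mul, Matrix.mul_assoc, ← Matrix.mul_assoc Oᵀ, hO, Matrix.one_mul, hRK]
  · conv_lhs => rw [← hTK, hTO]
    simp only [transpose_mul, Matrix.mul_assoc]

end Diagonalization

/-- The Siegel half-space, in the convention of Gaussian exponents `-½ Mx·x`: complex symmetric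
matrices with positive definite real part. -/
structure IsSiegel {n : Type*} [Fintype n] (M : Matrix n n ℂ) : Prop where
  symm : Mᵀ = M
  re_pos : ∀ y : n → ℂ, y ≠ 0 → 0 < (star y ⬝ᵥ M *ᵥ y).re

namespace IsSiegel

variable {n : Type*} [Fintype n] {M N : Matrix n n ℂ}

theorem add (h : IsSiegel M) (h' : IsSiegel N) : IsSiegel (M + N) where
  symm := by rw [transpose_add, h.symm, h'.symm]
  re_pos y hy := by
    rw [add_mulVec, dotProduct_add, Complex.add_re]
    exact _root_.add_pos (h.re_pos y hy) (h'.re_pos y hy)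

theorem map_conj (h : IsSiegel M) : IsSiegel (M.map (starRingEnd ℂ)) where
  symm := by rw [← transpose_map, h.symm]
  re_pos y hy := by
    have hconj : star y ⬝ᵥ M.map (starRingEnd ℂ) *ᵥ y
        = starRingEnd ℂ (star (star y) ⬝ᵥ M *ᵥ star y) := by
      simp [dotProduct, mulVec]
    rw [hconj, Complex.conj_re]
    exact h.re_pos _ (star_ne_zero.mpr hy)

theorem posDef_rePart (h : IsSiegel M) : (rePart M).PosDef := by
  refine Matrix.PosDef.of_dotProduct_mulVec_pos ?_ fun v hv => ?_
  · rw [IsHermitian, conjTranspose_eq_transpose_of_trivial, rePart, ← transpose_map, h.symm]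
  · have hv' : vecC v ≠ 0 := fun h0 => hv (funext fun i => by simpa using congrFun h0 i)
    simpa only [star_vecC, re_vecC_dotProduct_mulVec_vecC, star_trivial] using h.re_pos _ hv'

theorem add_I_smul (h : IsSiegel M) {P : Matrix n n ℝ} (hP : Pᵀ = P) :
    IsSiegel (M + Complex.I • toC P) where
  symm := by rw [transpose_add, transpose_smul, h.symm, ← toC_transpose, hP]
  re_pos y hy := by
    have hreal : star (star y ⬝ᵥ toC P *ᵥ y) = star y ⬝ᵥ toC P *ᵥ y := by
      conv_rhs => rw [star_dotProduct, star_mulVec, toC_conjTranspose, ← toC_transpose, hP,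
        ← dotProduct_mulVec]
    have him : (star y ⬝ᵥ toC P *ᵥ y).im = 0 := Complex.conj_eq_iff_im.mp hreal
    rw [add_mulVec, smul_mulVec, dotProduct_add, dotProduct_smul, Complex.add_re]
    simpa [him] using h.re_pos y hy

theorem sub_I_smul (h : IsSiegel M) {P : Matrix n n ℝ} (hP : Pᵀ = P) :
    IsSiegel (M - Complex.I • toC P) := by
  have := h.add_I_smul (P := -P) (by rw [transpose_neg, hP])
  rwa [toC_neg, smul_neg, ← sub_eq_add_neg] at this

variable [DecidableEq n]

theorem isUnit_det (h : IsSiegel M) : IsUnit M.det := by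
  rw [isUnit_iff_ne_zero]
  intro h0
  obtain ⟨v, hv, hMv⟩ := Matrix.exists_mulVec_eq_zero_iff.mpr h0
  simpa [hMv] using h.re_pos v hv

theorem mulVec_inv_mulVec (h : IsSiegel M) (w : n → ℂ) : M *ᵥ (M⁻¹ *ᵥ w) = w := by
  rw [mulVec_mulVec, mul_nonsing_inv _ h.isUnit_det, one_mulVec]

protected theorem one : IsSiegel (1 : Matrix n n ℂ) where
  symm := transpose_one
  re_pos y hy := by
    open scoped ComplexOrder in
    simpa using (Complex.pos_iff.mp (dotProduct_star_self_pos_iff.mpr hy)).1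

protected theorem inv (h : IsSiegel M) : IsSiegel M⁻¹ where
  symm := by rw [transpose_nonsing_inv, h.symm]
  re_pos v hv := by
    have hy : M⁻¹ *ᵥ v ≠ 0 := fun h0 => hv <| by rw [← h.mulVec_inv_mulVec v, h0, mulVec_zero]
    have := h.re_pos _ hy
    rw [h.mulVec_inv_mulVec, star_dotProduct] at this
    simpa using this

theorem congr (h : IsSiegel M) {K : Matrix n n ℝ} (hK : K.det ≠ 0) :
    IsSiegel ((toC K)ᵀ * M * toC K) where
  symm := by simp [transpose_mul, h.symm, Matrix.mul_assoc]
  re_pos y hy := by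
    have hKy : toC K *ᵥ y ≠ 0 := fun h0 => (isUnit_det_toC hK).ne_zero <|
      Matrix.exists_mulVec_eq_zero_iff.mp ⟨y, hy, h0⟩
    have := h.re_pos _ hKy
    rwa [star_mulVec, toC_conjTranspose, ← dotProduct_mulVec, mulVec_mulVec, mulVec_mulVec] at this

theorem exists_diagonal (h : IsSiegel M) :
    ∃ (K : Matrix n n ℝ) (d : n → ℝ), K.det ≠ 0 ∧
      M = (toC K)ᵀ * diagonal (fun i => 1 + Complex.I * (d i : ℂ)) * toC K := by
  have hT : (imPart M)ᵀ = imPart M := by rw [imPart, ← transpose_map, h.symm]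
  obtain ⟨K, d, hK, hR, hT⟩ := exists_simultaneous_diagonal h.posDef_rePart hT
  refine ⟨K, d, hK, ?_⟩
  have hd : diagonal (fun i => 1 + Complex.I * (d i : ℂ)) = 1 + Complex.I • toC (diagonal d) := by
    ext i j
    by_cases hij : i = j <;> simp [hij]
  conv_lhs => rw [← rePart_add_imPart M, hR, hT]
  rw [hd, Matrix.mul_add, Matrix.add_mul, toC_mul, toC_mul, toC_mul, toC_transpose]
  simp

end IsSiegel

section Exponents

variable {n : Type*} [Fintype n] [DecidableEq n]

theorem two_mul_dotProduct_sub_le {R : Matrix n n ℝ} (hR : R.PosDef) (p β : n → ℝ) :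
    2 * (p ⬝ᵥ β) - p ⬝ᵥ R *ᵥ p ≤ β ⬝ᵥ R⁻¹ *ᵥ β := by
  have hRt : Rᵀ = R := by simpa [IsHermitian] using hR.isHermitian
  have hinv : R *ᵥ (R⁻¹ *ᵥ β) = β := by
    rw [mulVec_mulVec, mul_nonsing_inv _ (isUnit_iff_ne_zero.mpr hR.det_pos.ne'), one_mulVec]
  have hcross : (R⁻¹ *ᵥ β) ⬝ᵥ R *ᵥ p = p ⬝ᵥ β := by
    rw [dotProduct_mulVec, ← mulVec_transpose, hRt, hinv, dotProduct_comm]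
  have h := hR.posSemidef.dotProduct_mulVec_nonneg (p - R⁻¹ *ᵥ β)
  simp only [star_trivial, mulVec_sub, hinv, sub_dotProduct, dotProduct_sub, hcross] at h
  rw [dotProduct_comm (R⁻¹ *ᵥ β) β] at h
  linarith

/-- The right-hand side is additive in `(M, w)`, unlike the left-hand side. -/
theorem IsSiegel.exists_re_dotProduct_inv_le {M : Matrix n n ℂ} (h : IsSiegel M) (w : n → ℂ) :
    ∃ p : n → ℝ,
      (w ⬝ᵥ M⁻¹ *ᵥ w).re ≤ 2 * (p ⬝ᵥ (Complex.re ∘ w)) - p ⬝ᵥ rePart M *ᵥ p := by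
  set y := M⁻¹ *ᵥ w
  refine ⟨Complex.re ∘ y, ?_⟩
  have hstar : star y = (2 : ℂ) • vecC (Complex.re ∘ y) - y := by
    ext i
    simpa using eq_sub_of_add_eq' (Complex.add_conj (y i))
  have hre : (star y ⬝ᵥ w).re = 2 * (Complex.re ∘ y ⬝ᵥ Complex.re ∘ w) - (w ⬝ᵥ y).re := by
    rw [hstar, sub_dotProduct, smul_dotProduct, Complex.sub_re, dotProduct_comm y,
      ← re_vecC_dotProduct]
    simp
  have hquad := re_star_dotProduct_mulVec h.symm y
  rw [h.mulVec_inv_mulVec, hre] at hquad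
  have him := h.posDef_rePart.posSemidef.dotProduct_mulVec_nonneg (Complex.im ∘ y)
  rw [star_trivial] at him
  linarith

theorem IsSiegel.re_dotProduct_inv_add_le {M N : Matrix n n ℂ} (hM : IsSiegel M)
    (hN : IsSiegel N) (b d : n → ℂ) :
    ((b + d) ⬝ᵥ (M + N)⁻¹ *ᵥ (b + d)).re ≤
      (Complex.re ∘ b) ⬝ᵥ (rePart M)⁻¹ *ᵥ (Complex.re ∘ b)
        + (Complex.re ∘ d) ⬝ᵥ (rePart N)⁻¹ *ᵥ (Complex.re ∘ d) := by
  obtain ⟨p, hp⟩ := (hM.add hN).exists_re_dotProduct_inv_le (b + d)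
  have hadd : Complex.re ∘ (b + d) = Complex.re ∘ b + Complex.re ∘ d := by ext i; simp
  rw [rePart_add, add_mulVec, dotProduct_add, hadd, dotProduct_add] at hp
  have h₁ := two_mul_dotProduct_sub_le hM.posDef_rePart p (Complex.re ∘ b)
  have h₂ := two_mul_dotProduct_sub_le hN.posDef_rePart p (Complex.re ∘ d)
  linarith

end Exponents

section SiegelRel

variable {n : Type*} [Fintype n] [DecidableEq n]

/-- The frame of the complex Lagrangian plane `{(x, iMx)}`, as a `2n × n` matrix. -/
def lagrangianFrame (M : Matrix n n ℂ) : Matrix (n ⊕ n) n ℂ := fromRows 1 (Complex.I • M)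

/-- The action of the symplectic group on the Siegel half-space, as a relation: `S` maps the
Lagrangian plane `{(x, iMx)}` into `{(x, iM'x)}`. -/
def SiegelRel (S : Matrix (n ⊕ n) (n ⊕ n) ℝ) (M M' : Matrix n n ℂ) : Prop :=
  ∃ X : Matrix n n ℂ, toC S * lagrangianFrame M = lagrangianFrame M' * X

theorem SiegelRel.refl (M : Matrix n n ℂ) : SiegelRel 1 M M := ⟨1, by simp⟩

theorem SiegelRel.trans {S S' : Matrix (n ⊕ n) (n ⊕ n) ℝ} {M M' M'' : Matrix n n ℂ}
    (h : SiegelRel S M M') (h' : SiegelRel S' M' M'') : SiegelRel (S' * S) M M'' := by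
  obtain ⟨X, hX⟩ := h
  obtain ⟨Y, hY⟩ := h'
  exact ⟨Y * X, by rw [toC_mul, Matrix.mul_assoc, hX, ← Matrix.mul_assoc, hY, Matrix.mul_assoc]⟩

theorem conjTranspose_lagrangianFrame_mul_J_mul {M : Matrix n n ℂ} (hM : Mᵀ = M) :
    (lagrangianFrame M)ᴴ * (toC (J n ℝ) * lagrangianFrame M)
      = (-(2 * Complex.I)) • toC (rePart M) := by
  have hMH : Mᴴ = M.map (starRingEnd ℂ) := by rw [conjTranspose, hM]; rfl
  have hI : star Complex.I = -Complex.I := Complex.conj_I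
  have hexpand : (lagrangianFrame M)ᴴ * (toC (J n ℝ) * lagrangianFrame M)
      = (-Complex.I) • (M + Mᴴ) := by
    rw [J, toC_fromBlocks, lagrangianFrame, fromBlocks_mul_fromRows,
      conjTranspose_fromRows_eq_fromCols_conjTranspose, fromCols_mul_fromRows, toC_neg,
      conjTranspose_smul, hI]
    simp [toC]
  rw [hexpand, hMH, add_map_conj, smul_smul]
  congr 1
  ring

/-- The Hermitian form `v ↦ ⟨v, iJv⟩` is invariant under real symplectic matrices, and restricts
to `2 Re M` on the frame of `M`. -/
theorem conjTranspose_mul_toC_rePart_mul {S : Matrix (n ⊕ n) (n ⊕ n) ℝ}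
    (hS : S ∈ symplecticGroup n ℝ) {M M' X : Matrix n n ℂ} (hM : Mᵀ = M) (hM' : M'ᵀ = M')
    (hX : toC S * lagrangianFrame M = lagrangianFrame M' * X) :
    Xᴴ * toC (rePart M') * X = toC (rePart M) := by
  have hJ : (toC S)ᴴ * toC (J n ℝ) * toC S = toC (J n ℝ) := by
    rw [toC_conjTranspose, ← toC_transpose, ← toC_mul, ← toC_mul,
      SymplecticGroup.mem_iff'.mp hS]
  have hinv : (-(2 * Complex.I)) • (Xᴴ * toC (rePart M') * X)
      = (-(2 * Complex.I)) • toC (rePart M) := by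
    calc (-(2 * Complex.I)) • (Xᴴ * toC (rePart M') * X)
      _ = (lagrangianFrame M' * X)ᴴ * (toC (J n ℝ) * (lagrangianFrame M' * X)) := by
        rw [← Matrix.smul_mul, ← Matrix.mul_smul, ← conjTranspose_lagrangianFrame_mul_J_mul hM',
          conjTranspose_mul]
        simp only [Matrix.mul_assoc]
      _ = (lagrangianFrame M)ᴴ * (((toC S)ᴴ * toC (J n ℝ) * toC S) * lagrangianFrame M) := by
        rw [← hX, conjTranspose_mul]
        simp only [Matrix.mul_assoc]
      _ = (-(2 * Complex.I)) • toC (rePart M) := by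
        rw [hJ, conjTranspose_lagrangianFrame_mul_J_mul hM]
  exact smul_right_injective _ (by simp) hinv

theorem SiegelRel.of_mul_eq_one {S T : Matrix (n ⊕ n) (n ⊕ n) ℝ} {M M' : Matrix n n ℂ}
    (h : SiegelRel S M M') (hS : S ∈ symplecticGroup n ℝ) (hTS : T * S = 1) (hM : IsSiegel M)
    (hM' : IsSiegel M') : SiegelRel T M' M := by
  obtain ⟨X, hX⟩ := h
  have hXdet : IsUnit X.det := by
    have hgram := conjTranspose_mul_toC_rePart_mul hS hM.symm hM'.symm hX
    refine isUnit_of_mul_isUnit_right (x := (Xᴴ * toC (rePart M')).det) ?_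
    rw [← det_mul, hgram]
    exact isUnit_det_toC hM.posDef_rePart.det_pos.ne'
  refine ⟨X⁻¹, ?_⟩
  calc toC T * lagrangianFrame M' = toC T * (lagrangianFrame M' * X) * X⁻¹ := by
        rw [Matrix.mul_assoc, Matrix.mul_assoc, mul_nonsing_inv _ hXdet, Matrix.mul_one]
    _ = lagrangianFrame M * X⁻¹ := by
        rw [← hX, ← Matrix.mul_assoc (toC T), ← toC_mul, hTS, toC_one, Matrix.one_mul]

/-- Conjugate by `[[1, 0], [i, 1]]`, which makes the matrix block upper triangular. -/
theorem det_fromBlocks_neg (U V : Matrix n n ℂ) :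
    (fromBlocks U V (-V) U).det = (U + Complex.I • V).det * (U - Complex.I • V).det := by
  have htriangular : fromBlocks 1 0 (-Complex.I • 1) 1 * fromBlocks U V (-V) U
      * fromBlocks 1 0 (Complex.I • 1) 1
      = fromBlocks (U + Complex.I • V) V 0 (U - Complex.I • V) := by
    rw [fromBlocks_multiply, fromBlocks_multiply]
    congr 1
    · simp
    · simp
    · simp [smul_smul]
    · simp [sub_eq_neg_add]
  simpa using congrArg det htriangular

theorem normSq_det_add_I_smul (U V : Matrix n n ℝ) :
    Complex.normSq (toC U + Complex.I • toC V).det = (fromBlocks U V (-V) U).det := by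
  have hconj : toC U - Complex.I • toC V = (toC U + Complex.I • toC V).map (starRingEnd ℂ) := by
    ext i j; simp [sub_eq_add_neg]
  have hdet := det_fromBlocks_neg (toC U) (toC V)
  rw [hconj, ← RingHom.mapMatrix_apply, ← RingHom.map_det, ← toC_neg, ← toC_fromBlocks, det_toC,
    Complex.mul_conj] at hdet
  exact_mod_cast hdet.symm

/-- For symplectic `S = [[A, B], [C, D]]`, the matrix `A + D + i (B - C)` is twice the part of `S`
that commutes with `J`, and `Sᵀ (S - J S J) = 1 + Sᵀ S`. -/
theorem normSq_det_complexLinearPart {A B C D : Matrix n n ℝ}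
    (hS : fromBlocks A B C D ∈ symplecticGroup n ℝ) :
    Complex.normSq (toC (A + D) + Complex.I • toC (B - C)).det
      = (1 + (fromBlocks A B C D)ᵀ * fromBlocks A B C D).det := by
  set S := fromBlocks A B C D with hSdef
  have hJ : Sᵀ * J n ℝ * S = J n ℝ := SymplecticGroup.mem_iff'.mp hS
  have hpart : fromBlocks (A + D) (B - C) (-(B - C)) (A + D) = S - J n ℝ * S * J n ℝ := by
    rw [hSdef, J, fromBlocks_multiply, fromBlocks_multiply, sub_eq_add_neg (fromBlocks A B C D),
      fromBlocks_neg, fromBlocks_add]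
    congr 1 <;> simp [sub_eq_add_neg, add_comm]
  have hgram : Sᵀ * (S - J n ℝ * S * J n ℝ) = 1 + Sᵀ * S := by
    rw [Matrix.mul_sub, ← Matrix.mul_assoc, ← Matrix.mul_assoc, hJ, J_squared, sub_neg_eq_add,
      add_comm]
  rw [normSq_det_add_I_smul, hpart, ← hgram, det_mul, det_transpose, SymplecticGroup.det_eq_one hS,
    one_mul]

theorem SiegelRel.det_rePart_mul {S : Matrix (n ⊕ n) (n ⊕ n) ℝ} (hS : S ∈ symplecticGroup n ℝ)
    {M : Matrix n n ℂ} (hM : Mᵀ = M) (h : SiegelRel S 1 M) :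
    (rePart M).det * (1 + Sᵀ * S).det = ‖(M + 1).det‖ ^ 2 := by
  obtain ⟨X, hX⟩ := h
  have hRe : Complex.normSq X.det * (rePart M).det = 1 := by
    have := congrArg det (conjTranspose_mul_toC_rePart_mul hS transpose_one hM hX)
    rw [det_mul, det_mul, det_conjTranspose, det_toC, rePart_one, toC_one, det_one,
      mul_right_comm] at this
    rw [← Complex.ofReal_inj, Complex.ofReal_mul, Complex.normSq_eq_conj_mul_self]
    exact this
  obtain ⟨A, B, C, D, rfl⟩ : ∃ A B C D, S = fromBlocks A B C D :=
    ⟨_, _, _, _, (fromBlocks_toBlocks S).symm⟩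
  have hpart : (M + 1) * X = toC (A + D) + Complex.I • toC (B - C) := by
    rw [toC_fromBlocks, lagrangianFrame, lagrangianFrame, fromBlocks_mul_fromRows,
      fromRows_mul] at hX
    obtain ⟨hX₁, hX₂⟩ := fromRows_inj hX
    have hMX : M * X = -Complex.I • (Complex.I • M * X) := by
      simp [smul_smul]
    rw [Matrix.add_mul, hMX, ← hX₁, ← hX₂, toC_add, toC_sub]
    simp only [Matrix.mul_one, Matrix.mul_smul, smul_add, smul_sub, smul_smul, neg_mul,
      Complex.I_mul_I, neg_neg, one_smul, neg_smul]
    abel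
  rw [← normSq_det_complexLinearPart hS, ← hpart, det_mul, map_mul, Complex.normSq_eq_norm_sq]
  linear_combination (‖(M + 1).det‖ ^ 2) * hRe

end SiegelRel

section Gaussian

variable {ι : Type*} [Fintype ι]

/-- The Gaussian `exp (-½ Mx·x + b·x)` with complex exponents `M` and `b`. -/
def gaussian (M : Matrix ι ι ℂ) (b : ι → ℂ) (x : EuclideanSpace ℝ ι) : ℂ :=
  Complex.exp (-(1 / 2) * (vecC x.ofLp ⬝ᵥ M *ᵥ vecC x.ofLp) + b ⬝ᵥ vecC x.ofLp)

theorem conj_gaussian (M : Matrix ι ι ℂ) (b : ι → ℂ) (x : EuclideanSpace ℝ ι) :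
    conj (gaussian M b x) = gaussian (M.map (starRingEnd ℂ)) (star b) x := by
  rw [gaussian, gaussian, ← Complex.exp_conj]
  simp [dotProduct, mulVec, map_ofNat]

theorem gaussian_mul_gaussian (M N : Matrix ι ι ℂ) (b d : ι → ℂ) (x : EuclideanSpace ℝ ι) :
    gaussian M b x * gaussian N d x = gaussian (M + N) (b + d) x := by
  rw [gaussian, gaussian, gaussian, ← Complex.exp_add, add_mulVec, dotProduct_add, add_dotProduct]
  congr 1
  ring

theorem prod_norm_cpow_half_sq {D : ι → ℂ} (hD : ∀ i, D i ≠ 0) :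
    ‖∏ i, ((Real.pi : ℂ) / (D i / 2)) ^ (1 / 2 : ℂ)‖ ^ 2 * ‖∏ i, D i‖
      = (2 * Real.pi) ^ Fintype.card ι := by
  have hfactor : ∀ i, ‖((Real.pi : ℂ) / (D i / 2)) ^ (1 / 2 : ℂ)‖ ^ 2 * ‖D i‖ = 2 * Real.pi := by
    intro i
    have hsq : (((Real.pi : ℂ) / (D i / 2)) ^ (1 / 2 : ℂ)) ^ 2 = (Real.pi : ℂ) / (D i / 2) := by
      simp
    rw [← norm_pow, hsq, ← norm_mul, show (Real.pi : ℂ) / (D i / 2) * D i = (2 * Real.pi : ℝ) by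
      have := hD i; push_cast; field_simp, Complex.norm_real, Real.norm_of_nonneg (by positivity)]
  rw [norm_prod, norm_prod, ← Finset.prod_pow, ← Finset.prod_mul_distrib,
    Finset.prod_congr rfl fun i _ => hfactor i]
  simp

variable [DecidableEq ι]

theorem gaussian_toEuclideanLin (K : Matrix ι ι ℝ) (N : Matrix ι ι ℂ) (c : ι → ℂ)
    (x : EuclideanSpace ℝ ι) :
    gaussian N c (toEuclideanLin K x)
      = gaussian ((toC K)ᵀ * N * toC K) ((toC K)ᵀ *ᵥ c) x := by
  rw [gaussian, gaussian, ← mulVec_mulVec, ← mulVec_mulVec, dotProduct_mulVec _ (toC K)ᵀ,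
    ← mulVec_transpose, transpose_transpose, mulVec_transpose, ← dotProduct_mulVec, toC_mulVec]
  rfl

theorem integral_comp_toEuclideanLin {F : Type*} [NormedAddCommGroup F] [NormedSpace ℝ F]
    {K : Matrix ι ι ℝ} (hK : K.det ≠ 0) (f : EuclideanSpace ℝ ι → F) :
    ∫ x, f (toEuclideanLin K x) = |K.det|⁻¹ • ∫ x, f x := by
  have hdet : LinearMap.det (toEuclideanLin K) = K.det := by
    rw [toEuclideanLin_eq_toLin_orthonormal, LinearMap.det_toLin]
  have hK' : LinearMap.det (toEuclideanLin K) ≠ 0 := by rwa [hdet]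
  have hemb : MeasurableEmbedding (toEuclideanLin K) :=
    (LinearMap.equivOfDetNeZero _ hK').toContinuousLinearEquiv.toHomeomorph.measurableEmbedding
  rw [← hemb.integral_map, Measure.map_linearMap_addHaar_eq_smul_addHaar _ hK',
    integral_smul_measure, ENNReal.toReal_ofReal (abs_nonneg _), abs_inv, hdet]

theorem integral_gaussian_diagonal {D : ι → ℂ} (hD : ∀ i, 0 < (D i).re) (c : ι → ℂ) :
    ∫ x, gaussian (diagonal D) c x = (∏ i, ((Real.pi : ℂ) / (D i / 2)) ^ (1 / 2 : ℂ)) *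
      Complex.exp (1 / 2 * (c ⬝ᵥ (diagonal D)⁻¹ *ᵥ c)) := by
  have hD0 : ∀ i, D i ≠ 0 := fun i h0 => by simpa [h0] using hD i
  have hinv : (diagonal D)⁻¹ = diagonal fun i => (D i)⁻¹ := by
    refine inv_eq_left_inv ?_
    rw [diagonal_mul_diagonal, ← diagonal_one]
    exact congrArg diagonal (funext fun i => inv_mul_cancel₀ (hD0 i))
  rw [← (EuclideanSpace.volume_preserving_symm_measurableEquiv_toLp ι).symm.integral_comp
    (MeasurableEquiv.measurableEmbedding _)]
  have hsum : ∀ v : ι → ℝ, gaussian (diagonal D) c (WithLp.toLp 2 v)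
      = Complex.exp (-∑ i, D i / 2 * (v i : ℂ) ^ 2 + ∑ i, c i * v i) := by
    intro v
    simp only [gaussian, dotProduct, mulVec_diagonal, vecC_apply, Finset.mul_sum,
      ← Finset.sum_neg_distrib]
    congr 2
    exact Finset.sum_congr rfl fun i _ => by ring
  refine (integral_congr_ae (Filter.Eventually.of_forall hsum)).trans ?_
  rw [GaussianFourier.integral_cexp_neg_sum_mul_add (fun i => by simpa using hD i) c,
    Finset.prod_mul_distrib, ← Complex.exp_sum, hinv]
  simp only [dotProduct, mulVec_diagonal, Finset.mul_sum]
  congr 2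
  refine Finset.sum_congr rfl fun i _ => ?_
  have := hD0 i
  field_simp
  ring

/-- The factor `c` is `(2π)^{n/2} (det M)^{-1/2}`, for a suitable branch of the square
root. -/
theorem IsSiegel.exists_integral_gaussian {M : Matrix ι ι ℂ} (hM : IsSiegel M) :
    ∃ c : ℂ, ‖c‖ ^ 2 * ‖M.det‖ = (2 * Real.pi) ^ Fintype.card ι ∧
      ∀ b, ∫ x, gaussian M b x = c * Complex.exp (1 / 2 * (b ⬝ᵥ M⁻¹ *ᵥ b)) := by
  obtain ⟨K, d, hK, hMK⟩ := hM.exists_diagonal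
  set D : ι → ℂ := fun i => 1 + Complex.I * (d i : ℂ)
  have hDre : ∀ i, 0 < (D i).re := fun i => by simp [D]
  have hD0 : ∀ i, D i ≠ 0 := fun i h0 => by simpa [h0] using hDre i
  have hKt : IsUnit (toC K)ᵀ.det := by rw [det_transpose]; exact isUnit_det_toC hK
  refine ⟨((|K.det|⁻¹ : ℝ) : ℂ) * ∏ i, ((Real.pi : ℂ) / (D i / 2)) ^ (1 / 2 : ℂ), ?_, fun b => ?_⟩
  · have hK' : |K.det| ≠ 0 := abs_ne_zero.mpr hK
    rw [hMK, det_mul, det_mul, det_transpose, det_diagonal, det_toC, norm_mul, norm_mul, norm_mul,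
      mul_pow, ← prod_norm_cpow_half_sq hD0]
    simp only [Complex.norm_real, Real.norm_eq_abs, abs_inv, abs_abs]
    field_simp
  · set c := (toC K)ᵀ⁻¹ *ᵥ b with hc
    have hb : (toC K)ᵀ *ᵥ c = b := by
      rw [hc, mulVec_mulVec, mul_nonsing_inv _ hKt, one_mulVec]
    have hexp : b ⬝ᵥ M⁻¹ *ᵥ b = c ⬝ᵥ (diagonal D)⁻¹ *ᵥ c := by
      rw [hMK, Matrix.mul_inv_rev, Matrix.mul_inv_rev, ← mulVec_mulVec, ← mulVec_mulVec, ← hc,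
        dotProduct_mulVec, ← mulVec_transpose, transpose_nonsing_inv, ← hc]
    have hgauss : ∀ x, gaussian M b x = gaussian (diagonal D) c (toEuclideanLin K x) := fun x => by
      rw [gaussian_toEuclideanLin, ← hMK, hb]
    simp only [hgauss, hexp]
    rw [integral_comp_toEuclideanLin hK, integral_gaussian_diagonal hDre, Complex.real_smul,
      mul_assoc]

end Gaussian

section Schwartz

theorem norm_iteratedFDeriv_cexp (i : ℕ) (z : ℂ) :
    ‖iteratedFDeriv ℝ i Complex.exp z‖ = ‖iteratedFDeriv ℝ i Complex.exp 0‖ * Real.exp z.re := by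
  have hc : ContDiff ℝ i Complex.exp := Complex.contDiff_exp
  have hshift : (fun w => Complex.exp (z + w)) = Complex.exp z • Complex.exp := by
    ext w; simp [Complex.exp_add]
  have hderiv := iteratedFDeriv_comp_add_left (𝕜 := ℝ) (f := Complex.exp) i z 0
  rw [hshift, add_zero, iteratedFDeriv_const_smul_apply hc.contDiffAt] at hderiv
  rw [← hderiv, norm_smul, Complex.norm_exp, mul_comm]

theorem exists_norm_iteratedFDeriv_cexp_comp_le {V : Type*} [NormedAddCommGroup V]
    [NormedSpace ℝ V] {f : V → ℂ} (hf : f.HasTemperateGrowth) (m : ℕ) :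
    ∃ (l : ℕ) (C : ℝ), 0 ≤ C ∧ ∀ x,
      ‖iteratedFDeriv ℝ m (fun x => Complex.exp (f x)) x‖
        ≤ C * (1 + ‖x‖) ^ l * Real.exp (f x).re := by
  obtain ⟨l, B, hB, hfB⟩ := hf.norm_iteratedFDeriv_le_uniform m
  set A : ℝ := ∑ i ∈ Finset.range (m + 1), ‖iteratedFDeriv ℝ i Complex.exp 0‖
  have : 0 ≤ A := Finset.sum_nonneg fun i _ => norm_nonneg _
  have hexp (x : V) (i : ℕ) (hi : i ≤ m) :
      ‖iteratedFDeriv ℝ i Complex.exp (f x)‖ ≤ A * Real.exp (f x).re := by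
    rw [norm_iteratedFDeriv_cexp]
    gcongr
    exact Finset.single_le_sum (f := fun i => ‖iteratedFDeriv ℝ i Complex.exp 0‖)
      (fun i _ => norm_nonneg _) (Finset.mem_range.mpr (by omega))
  have hinner (x : V) (i : ℕ) (hi : 1 ≤ i) (him : i ≤ m) :
      ‖iteratedFDeriv ℝ i f x‖ ≤ ((B + 1) * (1 + ‖x‖) ^ l) ^ i := by
    have hone : 1 ≤ (B + 1) * (1 + ‖x‖) ^ l :=
      one_le_mul_of_one_le_of_one_le (by linarith)
        (one_le_pow₀ (by linarith [norm_nonneg x]))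
    calc ‖iteratedFDeriv ℝ i f x‖ ≤ B * (1 + ‖x‖) ^ l := hfB i him x
      _ ≤ (B + 1) * (1 + ‖x‖) ^ l := by gcongr; linarith
      _ ≤ _ := le_self_pow₀ hone (by omega)
  refine ⟨l * m, m.factorial * A * (B + 1) ^ m, by positivity, fun x => ?_⟩
  calc ‖iteratedFDeriv ℝ m (fun x => Complex.exp (f x)) x‖
      ≤ m.factorial * (A * Real.exp (f x).re) * ((B + 1) * (1 + ‖x‖) ^ l) ^ m :=
        norm_iteratedFDeriv_comp_le (N := m) Complex.contDiff_exp
          (hf.1.of_le (mod_cast le_top)) le_rfl x (hexp x) (hinner x)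
    _ = _ := by rw [pow_mul, mul_pow]; ring

theorem decay_cexp_comp {V : Type*} [NormedAddCommGroup V] [NormedSpace ℝ V] {f : V → ℂ}
    (hf : f.HasTemperateGrowth)
    (hd : ∀ k : ℕ, ∃ C : ℝ, ∀ x, (1 + ‖x‖) ^ k * Real.exp (f x).re ≤ C) (k m : ℕ) :
    ∃ C, ∀ x, ‖x‖ ^ k * ‖iteratedFDeriv ℝ m (fun x => Complex.exp (f x)) x‖ ≤ C := by
  obtain ⟨l, A, hA, hfA⟩ := exists_norm_iteratedFDeriv_cexp_comp_le hf m
  obtain ⟨C, hC⟩ := hd (k + l)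
  refine ⟨A * C, fun x => ?_⟩
  calc ‖x‖ ^ k * ‖iteratedFDeriv ℝ m (fun x => Complex.exp (f x)) x‖
      ≤ (1 + ‖x‖) ^ k * (A * (1 + ‖x‖) ^ l * Real.exp (f x).re) := by
        gcongr
        · linarith
        · exact hfA x
    _ = A * ((1 + ‖x‖) ^ (k + l) * Real.exp (f x).re) := by rw [pow_add]; ring
    _ ≤ _ := by gcongr; exact hC x

theorem hasTemperateGrowth_cexp_comp {V : Type*} [NormedAddCommGroup V] [NormedSpace ℝ V]
    {f : V → ℂ} (hf : f.HasTemperateGrowth) (hre : ∀ x, (f x).re ≤ 0) :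
    (fun x => Complex.exp (f x)).HasTemperateGrowth := by
  refine ⟨Complex.contDiff_exp.comp hf.1, fun m => ?_⟩
  obtain ⟨l, A, hA, hfA⟩ := exists_norm_iteratedFDeriv_cexp_comp_le hf m
  exact ⟨l, A, fun x => (hfA x).trans
    (mul_le_of_le_one_right (by positivity) (Real.exp_le_one_iff.mpr (hre x)))⟩

theorem exists_pow_mul_exp_quadratic_le {c : ℝ} (hc : 0 < c) (B : ℝ) (k : ℕ) :
    ∃ C : ℝ, ∀ r : ℝ, 0 ≤ r → (1 + r) ^ k * Real.exp (-c * r ^ 2 + B * r) ≤ C := by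
  refine ⟨k.factorial * Real.exp (1 + (B + 1) ^ 2 / (4 * c)), fun r hr => ?_⟩
  have hpow : (1 + r) ^ k ≤ k.factorial * Real.exp (1 + r) := by
    have := Real.pow_div_factorial_le_exp (1 + r) (by linarith) k
    rwa [div_le_iff₀' (by positivity)] at this
  have hexp : (1 + r) + (-c * r ^ 2 + B * r) ≤ 1 + (B + 1) ^ 2 / (4 * c) := by
    have hsquare : (B + 1) ^ 2 / (4 * c) - (B + 1) * r + c * r ^ 2
        = (2 * c * r - (B + 1)) ^ 2 / (4 * c) := by field_simp; ring
    have : 0 ≤ (2 * c * r - (B + 1)) ^ 2 / (4 * c) := by positivity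
    linarith
  calc (1 + r) ^ k * Real.exp (-c * r ^ 2 + B * r)
      ≤ k.factorial * Real.exp (1 + r) * Real.exp (-c * r ^ 2 + B * r) := by gcongr
    _ = k.factorial * Real.exp ((1 + r) + (-c * r ^ 2 + B * r)) := by
        rw [Real.exp_add (1 + r)]; ring
    _ ≤ _ := by gcongr

variable {ι : Type*} [Fintype ι]

theorem exists_pos_mul_norm_sq_le {R : Matrix ι ι ℝ} (hR : R.PosDef) :
    ∃ c : ℝ, 0 < c ∧ ∀ x : EuclideanSpace ℝ ι, c * ‖x‖ ^ 2 ≤ x.ofLp ⬝ᵥ R *ᵥ x.ofLp := by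
  classical
  obtain ⟨K, hK, rfl⟩ := exists_eq_transpose_mul_self hR
  set T := (toEuclideanLin K⁻¹).toContinuousLinearMap
  refine ⟨(‖T‖ ^ 2 + 1)⁻¹, by positivity, fun x => ?_⟩
  have hTK : T (toEuclideanLin K x) = x := by
    apply WithLp.ofLp_injective
    simp [T, mulVec_mulVec, nonsing_inv_mul _ hK]
  have hquad : x.ofLp ⬝ᵥ (Kᵀ * K) *ᵥ x.ofLp = ‖toEuclideanLin K x‖ ^ 2 := by
    rw [← mulVec_mulVec, dotProduct_mulVec, ← mulVec_transpose, transpose_transpose,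
      EuclideanSpace.real_norm_sq_eq]
    simp [dotProduct, sq]
  rw [inv_mul_le_iff₀ (by positivity), hquad]
  calc ‖x‖ ^ 2 = ‖T (toEuclideanLin K x)‖ ^ 2 := by rw [hTK]
    _ ≤ (‖T‖ * ‖toEuclideanLin K x‖) ^ 2 := by gcongr; exact T.le_opNorm _
    _ ≤ (‖T‖ ^ 2 + 1) * ‖toEuclideanLin K x‖ ^ 2 := by
      rw [mul_pow]; gcongr; linarith

theorem hasTemperateGrowth_coord (i : ι) :
    (fun x : EuclideanSpace ℝ ι => (x.ofLp i : ℂ)).HasTemperateGrowth :=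
  (Complex.ofRealCLM.comp (EuclideanSpace.proj i : EuclideanSpace ℝ ι →L[ℝ] ℝ)).hasTemperateGrowth

theorem hasTemperateGrowth_gaussian_exponent (M : Matrix ι ι ℂ) (b : ι → ℂ) :
    (fun x : EuclideanSpace ℝ ι => -(1 / 2) * (vecC x.ofLp ⬝ᵥ M *ᵥ vecC x.ofLp)
      + b ⬝ᵥ vecC x.ofLp).HasTemperateGrowth := by
  have := hasTemperateGrowth_coord (ι := ι)
  simp only [dotProduct, mulVec, vecC_apply]
  fun_prop

theorem IsSiegel.exists_re_gaussian_exponent_le {M : Matrix ι ι ℂ} (hM : IsSiegel M) (b : ι → ℂ) :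
    ∃ c B : ℝ, 0 < c ∧ ∀ x : EuclideanSpace ℝ ι,
      (-(1 / 2) * (vecC x.ofLp ⬝ᵥ M *ᵥ vecC x.ofLp) + b ⬝ᵥ vecC x.ofLp).re
        ≤ -c * ‖x‖ ^ 2 + B * ‖x‖ := by
  obtain ⟨c, hc, hcR⟩ := exists_pos_mul_norm_sq_le hM.posDef_rePart
  refine ⟨c / 2, ∑ i, ‖b i‖, by positivity, fun x => ?_⟩
  have hquad : (-(1 / 2) * (vecC x.ofLp ⬝ᵥ M *ᵥ vecC x.ofLp)).re
      = -(1 / 2) * (x.ofLp ⬝ᵥ rePart M *ᵥ x.ofLp) := by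
    rw [← re_vecC_dotProduct_mulVec_vecC, ← Complex.re_ofReal_mul]
    simp
  have hlin : (b ⬝ᵥ vecC x.ofLp).re ≤ (∑ i, ‖b i‖) * ‖x‖ := by
    refine (Complex.re_le_norm _).trans ?_
    rw [dotProduct, Finset.sum_mul]
    refine (norm_sum_le _ _).trans (Finset.sum_le_sum fun i _ => ?_)
    rw [norm_mul, vecC_apply, Complex.norm_real]
    gcongr
    exact PiLp.norm_apply_le x i
  rw [Complex.add_re, hquad]
  linarith [hcR x]

/-- The Gaussian `exp (-½ Mx·x + b·x)` as a Schwartz function, for `M` in the Siegel half-space. -/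
def gaussianSchwartz {M : Matrix ι ι ℂ} (hM : IsSiegel M) (b : ι → ℂ) :
    𝓢(EuclideanSpace ℝ ι, ℂ) where
  toFun := gaussian M b
  smooth' := Complex.contDiff_exp.comp (hasTemperateGrowth_gaussian_exponent M b).1
  decay' := by
    refine decay_cexp_comp (hasTemperateGrowth_gaussian_exponent M b) fun k => ?_
    obtain ⟨c, B, hc, hexp⟩ := hM.exists_re_gaussian_exponent_le b
    obtain ⟨C, hC⟩ := exists_pow_mul_exp_quadratic_le hc B k
    refine ⟨C, fun x => le_trans ?_ (hC ‖x‖ (norm_nonneg x))⟩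
    gcongr
    exact hexp x

@[simp] theorem coe_gaussianSchwartz {M : Matrix ι ι ℂ} (hM : IsSiegel M) (b : ι → ℂ) :
    ⇑(gaussianSchwartz hM b) = gaussian M b := rfl

end Schwartz

section InnerProducts

variable {ι : Type*} [Fintype ι] {M N : Matrix ι ι ℂ}

theorem inner_toLp_gaussianSchwartz (hM : IsSiegel M) (hN : IsSiegel N) (b d : ι → ℂ) :
    inner ℂ ((gaussianSchwartz hN d).toLp 2) ((gaussianSchwartz hM b).toLp 2)
      = ∫ x, gaussian (M + N.map (starRingEnd ℂ)) (b + star d) x := by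
  rw [SchwartzMap.inner_toL2_toL2_eq _ _ volume]
  refine integral_congr_ae (Filter.Eventually.of_forall fun x => ?_)
  simp only [RCLike.inner_apply, coe_gaussianSchwartz]
  rw [conj_gaussian, gaussian_mul_gaussian]

variable [DecidableEq ι]

theorem norm_gaussianSchwartz_pow_four (hM : IsSiegel M) (b : ι → ℂ) :
    ‖(gaussianSchwartz hM b).toLp 2‖ ^ 4 * (2 ^ Fintype.card ι * (rePart M).det)
      = (2 * Real.pi) ^ Fintype.card ι *
        Real.exp ((Complex.re ∘ b) ⬝ᵥ (rePart M)⁻¹ *ᵥ (Complex.re ∘ b)) ^ 2 := by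
  set β : ι → ℝ := Complex.re ∘ b
  have hdet : 0 < (rePart M).det := hM.posDef_rePart.det_pos
  have hb : b + star b = (2 : ℂ) • vecC β := by
    ext i
    exact (Complex.add_conj (b i)).trans (by simp [β])
  obtain ⟨c, hc, hint⟩ := (hM.add hM.map_conj).exists_integral_gaussian
  have : Invertible (2 : ℂ) := invertibleOfNonzero two_ne_zero
  have hexp : (b + star b) ⬝ᵥ (M + M.map (starRingEnd ℂ))⁻¹ *ᵥ (b + star b)
      = 2 * ((β ⬝ᵥ (rePart M)⁻¹ *ᵥ β : ℝ) : ℂ) := by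
    rw [add_map_conj, hb, Matrix.inv_smul _ (2 : ℂ) (isUnit_det_toC hdet.ne'), ← toC_inv hdet.ne',
      mulVec_smul, smul_mulVec, dotProduct_smul, smul_dotProduct, dotProduct_smul, toC_mulVec,
      vecC_dotProduct]
    simp
  have hnorm : ‖(gaussianSchwartz hM b).toLp 2‖ ^ 2
      = ‖c‖ * Real.exp (β ⬝ᵥ (rePart M)⁻¹ *ᵥ β) := by
    have hself := inner_self_eq_norm_sq_to_K (𝕜 := ℂ) ((gaussianSchwartz hM b).toLp 2)
    rw [inner_toLp_gaussianSchwartz, hint, hexp] at hself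
    simpa [Complex.norm_exp] using (congrArg norm hself).symm
  rw [add_map_conj, det_smul, det_toC, norm_mul, norm_pow, Complex.norm_real,
    Real.norm_of_nonneg hdet.le, RCLike.norm_ofNat] at hc
  rw [← hc, show 4 = 2 * 2 from rfl, pow_mul, hnorm]
  ring

theorem norm_inner_gaussianSchwartz_pow_four_le (hM : IsSiegel M) (hN : IsSiegel N)
    (b d : ι → ℂ) :
    ‖inner ℂ ((gaussianSchwartz hN d).toLp 2) ((gaussianSchwartz hM b).toLp 2)‖ ^ 4
        * ‖(M + N.map (starRingEnd ℂ)).det‖ ^ 2 ≤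
      4 ^ Fintype.card ι * (rePart M).det * (rePart N).det *
        ‖(gaussianSchwartz hM b).toLp 2‖ ^ 4 * ‖(gaussianSchwartz hN d).toLp 2‖ ^ 4 := by
  obtain ⟨c, hc, hint⟩ := (hM.add hN.map_conj).exists_integral_gaussian
  rw [inner_toLp_gaussianSchwartz hM hN, hint, norm_mul]
  set e := ‖Complex.exp (1 / 2 *
    ((b + star d) ⬝ᵥ (M + N.map (starRingEnd ℂ))⁻¹ *ᵥ (b + star d)))‖ with he
  set e₁ := Real.exp ((Complex.re ∘ b) ⬝ᵥ (rePart M)⁻¹ *ᵥ (Complex.re ∘ b)) with he₁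
  set e₂ := Real.exp ((Complex.re ∘ d) ⬝ᵥ (rePart N)⁻¹ *ᵥ (Complex.re ∘ d)) with he₂
  have hexp : e ^ 2 ≤ e₁ * e₂ := by
    have hreN : rePart (N.map (starRingEnd ℂ)) = rePart N := by ext i j; simp [rePart]
    have hred : Complex.re ∘ star d = Complex.re ∘ d := by ext i; simp
    have hle := hM.re_dotProduct_inv_add_le hN.map_conj b (star d)
    rw [hreN, hred] at hle
    rw [he, he₁, he₂, Complex.norm_exp, ← Real.exp_nat_mul, ← Real.exp_add, Real.exp_le_exp]
    refine le_trans (le_of_eq ?_) hle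
    rw [← Complex.re_ofReal_mul]
    push_cast
    ring_nf
  calc (‖c‖ * e) ^ 4 * ‖(M + N.map (starRingEnd ℂ)).det‖ ^ 2
      = (‖c‖ ^ 2 * ‖(M + N.map (starRingEnd ℂ)).det‖) ^ 2 * (e ^ 2) ^ 2 := by ring
    _ ≤ ((2 * Real.pi) ^ Fintype.card ι) ^ 2 * (e₁ * e₂) ^ 2 := by rw [hc]; gcongr
    _ = ((2 * Real.pi) ^ Fintype.card ι * e₁ ^ 2) * ((2 * Real.pi) ^ Fintype.card ι * e₂ ^ 2) := by
      ring
    _ = _ := by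
      rw [← norm_gaussianSchwartz_pow_four hM b, ← norm_gaussianSchwartz_pow_four hN d,
        show (4 : ℝ) ^ Fintype.card ι = 2 ^ Fintype.card ι * 2 ^ Fintype.card ι by
          rw [← mul_pow]; norm_num]
      ring

end InnerProducts

namespace GeneratingFunction

variable {n : ℕ} (W : GeneratingFunction n) {M : Matrix (Fin n) (Fin n) ℂ}

/-- The action of `S_W` on the Siegel half-space: the quadratic Fourier transforms of `W` map
Gaussians with quadratic coefficient `M` to Gaussians with quadratic coefficient
`Lᵀ (M - iQ)⁻¹ L - iP`. -/
def siegelImage (M : Matrix (Fin n) (Fin n) ℂ) : Matrix (Fin n) (Fin n) ℂ :=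
  (toC W.L)ᵀ * (M - Complex.I • toC W.Q)⁻¹ * toC W.L - Complex.I • toC W.P

/-- The linear coefficient of the image of `gaussian M b` under a quadratic Fourier transform. -/
def linearImage (M : Matrix (Fin n) (Fin n) ℂ) (b : Fin n → ℂ) : Fin n → ℂ :=
  -Complex.I • (((toC W.L)ᵀ * (M - Complex.I • toC W.Q)⁻¹) *ᵥ b)

theorem isSiegel_siegelImage (hM : IsSiegel M) : IsSiegel (W.siegelImage M) :=
  ((hM.sub_I_smul W.Q_symm).inv.congr W.det_L_ne_zero).sub_I_smul W.P_symm

theorem exists_preimage (hM : IsSiegel M) (b : Fin n → ℂ) :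
    ∃ N a, IsSiegel N ∧ W.siegelImage N = M ∧ W.linearImage N a = b := by
  have hT := hM.add_I_smul W.P_symm
  have hL : IsUnit (toC W.L).det := isUnit_det_toC W.det_L_ne_zero
  have hLt : IsUnit (toC W.L)ᵀ.det := by rwa [det_transpose]
  have hN := hT.inv.congr (K := W.Lᵀ) (by rw [det_transpose]; exact W.det_L_ne_zero)
  rw [toC_transpose, transpose_transpose] at hN
  set N := toC W.L * (M + Complex.I • toC W.P)⁻¹ * (toC W.L)ᵀ with hNdef
  have hinv : (toC W.L)ᵀ * N⁻¹ * toC W.L = M + Complex.I • toC W.P := by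
    rw [hNdef, Matrix.mul_inv_rev, Matrix.mul_inv_rev, nonsing_inv_nonsing_inv _ hT.isUnit_det,
      mul_nonsing_inv_cancel_left _ _ hLt, nonsing_inv_mul_cancel_right _ _ hL]
  refine ⟨N + Complex.I • toC W.Q, Complex.I • ((N * (toC W.L)ᵀ⁻¹) *ᵥ b),
    hN.add_I_smul W.Q_symm, ?_, ?_⟩
  · rw [siegelImage, add_sub_cancel_right, hinv, add_sub_cancel_right]
  · rw [linearImage, add_sub_cancel_right, mulVec_smul, mulVec_mulVec, smul_smul, neg_mul,
      Complex.I_mul_I, neg_neg, one_smul, Matrix.mul_assoc,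
      nonsing_inv_mul_cancel_left _ _ hN.isUnit_det, mul_nonsing_inv _ hLt, one_mulVec]

theorem siegelRel_siegelImage (hM : IsSiegel M) :
    SiegelRel W.freeMatrix M (W.siegelImage M) := by
  set N := M - Complex.I • toC W.Q with hN
  have hM' : M = N + Complex.I • toC W.Q := (sub_add_cancel _ _).symm
  have hNunit : IsUnit N.det := (hM.sub_I_smul W.Q_symm).isUnit_det
  have hcancel : (toC W.L)ᵀ * (N⁻¹ * (toC W.L * ((toC W.L)⁻¹ * N))) = (toC W.L)ᵀ := by
    rw [mul_nonsing_inv_cancel_left _ _ (isUnit_det_toC W.det_L_ne_zero),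
      nonsing_inv_mul _ hNunit, Matrix.mul_one]
  refine ⟨Complex.I • ((toC W.L)⁻¹ * N), ?_⟩
  rw [siegelImage, ← hN, hM', freeMatrix, toC_fromBlocks, lagrangianFrame, lagrangianFrame,
    fromBlocks_mul_fromRows, fromRows_mul]
  simp only [toC_mul, toC_sub, toC_inv W.det_L_ne_zero, toC_transpose, Matrix.mul_one,
    Matrix.one_mul, Matrix.mul_smul, Matrix.smul_mul, Matrix.mul_add, Matrix.sub_mul, smul_add,
    smul_sub, smul_smul, Complex.I_mul_I, neg_smul, one_smul, Matrix.mul_neg, Matrix.neg_mul,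
    Matrix.mul_assoc, hcancel]
  congr 1 <;> module

theorem exp_eval_mul_gaussian (b : Fin n → ℂ) (x x' : E n) :
    Complex.exp (Complex.I * (W.eval x x' : ℂ)) * gaussian M b x'
      = Complex.exp (Complex.I / 2 * (vecC x.ofLp ⬝ᵥ toC W.P *ᵥ vecC x.ofLp))
        * gaussian (M - Complex.I • toC W.Q) (b - Complex.I • (toC W.L *ᵥ vecC x.ofLp)) x' := by
  rw [gaussian, gaussian, ← Complex.exp_add, ← Complex.exp_add, eval]
  congr 1
  simp only [Complex.ofReal_add, Complex.ofReal_sub, Complex.ofReal_mul, ← vecC_dotProduct,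
    ← toC_mulVec, sub_mulVec, smul_mulVec, dotProduct_sub, dotProduct_smul, sub_dotProduct,
    smul_dotProduct, smul_eq_mul]
  rw [dotProduct_comm (toC W.P *ᵥ vecC x.ofLp), dotProduct_comm (toC W.Q *ᵥ vecC x'.ofLp)]
  push_cast
  ring

theorem exp_mul_exp_eq_gaussian_siegelImage (hM : IsSiegel M) (b : Fin n → ℂ) (x : E n) :
    let u := b - Complex.I • (toC W.L *ᵥ vecC x.ofLp)
    let N := M - Complex.I • toC W.Q
    Complex.exp (Complex.I / 2 * (vecC x.ofLp ⬝ᵥ toC W.P *ᵥ vecC x.ofLp))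
        * Complex.exp (1 / 2 * (u ⬝ᵥ N⁻¹ *ᵥ u))
      = Complex.exp (1 / 2 * (b ⬝ᵥ N⁻¹ *ᵥ b))
        * gaussian (W.siegelImage M) (W.linearImage M b) x := by
  intro u N
  set v := toC W.L *ᵥ vecC x.ofLp with hv
  have hsymm : v ⬝ᵥ N⁻¹ *ᵥ b = b ⬝ᵥ N⁻¹ *ᵥ v := by
    rw [dotProduct_mulVec, ← mulVec_transpose, (hM.sub_I_smul W.Q_symm).inv.symm, dotProduct_comm]
  have hlin : W.linearImage M b ⬝ᵥ vecC x.ofLp = -Complex.I * (b ⬝ᵥ N⁻¹ *ᵥ v) := by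
    rw [linearImage, smul_dotProduct, ← mulVec_mulVec, mulVec_transpose, ← dotProduct_mulVec,
      ← hv, dotProduct_comm, hsymm, smul_eq_mul]
  have hquad : vecC x.ofLp ⬝ᵥ W.siegelImage M *ᵥ vecC x.ofLp
      = v ⬝ᵥ N⁻¹ *ᵥ v - Complex.I * (vecC x.ofLp ⬝ᵥ toC W.P *ᵥ vecC x.ofLp) := by
    rw [siegelImage, sub_mulVec, dotProduct_sub, smul_mulVec, dotProduct_smul, ← mulVec_mulVec,
      ← mulVec_mulVec, dotProduct_mulVec, ← mulVec_transpose, transpose_transpose, smul_eq_mul]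
  rw [gaussian, hlin, hquad, ← Complex.exp_add, ← Complex.exp_add]
  simp only [u, ← hv, mulVec_sub, mulVec_smul, sub_dotProduct, dotProduct_sub, smul_dotProduct,
    dotProduct_smul, hsymm, smul_eq_mul]
  congr 1
  linear_combination (1 / 2 * (v ⬝ᵥ N⁻¹ *ᵥ v)) * Complex.I_mul_I

theorem exists_fourierIntegral_gaussian (hM : IsSiegel M) (b : Fin n → ℂ) (m : ℤ) :
    ∃ c : ℂ, ∀ x, W.fourierIntegral m (gaussianSchwartz hM b) x
      = c * gaussian (W.siegelImage M) (W.linearImage M b) x := by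
  obtain ⟨c, -, hc⟩ := (hM.sub_I_smul W.Q_symm).exists_integral_gaussian
  have hintegral (x : E n) : ∫ x', Complex.exp (Complex.I * (W.eval x x' : ℂ)) * gaussian M b x'
      = c * (Complex.exp (1 / 2 * (b ⬝ᵥ (M - Complex.I • toC W.Q)⁻¹ *ᵥ b))
        * gaussian (W.siegelImage M) (W.linearImage M b) x) := by
    simp only [exp_eval_mul_gaussian]
    rw [integral_const_mul, hc, ← W.exp_mul_exp_eq_gaussian_siegelImage hM, mul_left_comm]
  simp only [fourierIntegral, coe_gaussianSchwartz, hintegral, ← mul_assoc]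
  exact ⟨_, fun x => rfl⟩

end GeneratingFunction

section TransformsGaussians

variable {n : ℕ} {U V : L2 n ≃ₗᵢ[ℂ] L2 n} {S T : Sp n} {W : GeneratingFunction n} {m : ℤ}
  {M : Matrix (Fin n) (Fin n) ℂ}

theorem toLp_gaussianSchwartz_ne_zero (hM : IsSiegel M) (b : Fin n → ℂ) :
    (gaussianSchwartz hM b).toLp 2 volume ≠ 0 := by
  intro h0
  have hnorm := norm_gaussianSchwartz_pow_four hM b
  rw [h0, norm_zero, zero_pow (by norm_num), zero_mul] at hnorm
  exact absurd hnorm (by positivity)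

theorem GeneratingFunction.IsQuadraticFourierTransform.apply_gaussian
    (hU : W.IsQuadraticFourierTransform m U) (hM : IsSiegel M) (b : Fin n → ℂ) :
    ∃ c : ℂ, c ≠ 0 ∧ U ((gaussianSchwartz hM b).toLp 2 volume)
      = c • (gaussianSchwartz (W.isSiegel_siegelImage hM) (W.linearImage M b)).toLp 2 volume := by
  obtain ⟨c, hc⟩ := W.exists_fourierIntegral_gaussian hM b m
  set G' := gaussianSchwartz (W.isSiegel_siegelImage hM) (W.linearImage M b)
  have heq : U ((gaussianSchwartz hM b).toLp 2 volume) = c • G'.toLp 2 volume := by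
    refine Lp.ext ?_
    filter_upwards [hU.2 (gaussianSchwartz hM b), Lp.coeFn_smul c (G'.toLp 2 volume),
      G'.coeFn_toLp 2 volume] with x hUx hsmul hG'
    rw [hUx, hsmul, hc, Pi.smul_apply, hG', smul_eq_mul, coe_gaussianSchwartz]
  refine ⟨c, ?_, heq⟩
  rintro rfl
  rw [zero_smul] at heq
  exact toLp_gaussianSchwartz_ne_zero hM b (U.map_eq_zero_iff.mp heq)

/-- `U` maps Gaussians to multiples of Gaussians, acting on their quadratic coefficients
through `S`. -/
def TransformsGaussians (U : L2 n ≃ₗᵢ[ℂ] L2 n) (S : Sp n) : Prop :=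
  ∀ (M : Matrix (Fin n) (Fin n) ℂ) (hM : IsSiegel M) (b : Fin n → ℂ),
    ∃ (M' : Matrix (Fin n) (Fin n) ℂ) (hM' : IsSiegel M') (b' : Fin n → ℂ) (c : ℂ),
      SiegelRel S.1 M M' ∧
      U ((gaussianSchwartz hM b).toLp 2 volume) = c • (gaussianSchwartz hM' b').toLp 2 volume

namespace TransformsGaussians

theorem one : TransformsGaussians (1 : L2 n ≃ₗᵢ[ℂ] L2 n) 1 := fun M hM b =>
  ⟨M, hM, b, 1, SiegelRel.refl M, (one_smul ℂ _).symm⟩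

theorem mul (hU : TransformsGaussians U S) (hV : TransformsGaussians V T) :
    TransformsGaussians (U * V) (S * T) := by
  intro M hM b
  obtain ⟨M', hM', b', c, hrel, hc⟩ := hV M hM b
  obtain ⟨M'', hM'', b'', c', hrel', hc'⟩ := hU M' hM' b'
  refine ⟨M'', hM'', b'', c * c', hrel.trans hrel', ?_⟩
  rw [LinearIsometryEquiv.coe_mul, Function.comp_apply, hc, map_smul, hc', smul_smul]

end TransformsGaussians

theorem GeneratingFunction.IsQuadraticFourierTransform.transformsGaussians
    (hU : W.IsQuadraticFourierTransform m U) : TransformsGaussians U W.freeSymplectic := by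
  intro M hM b
  obtain ⟨c, -, hc⟩ := hU.apply_gaussian hM b
  exact ⟨_, _, _, c, W.siegelRel_siegelImage hM, hc⟩

theorem GeneratingFunction.IsQuadraticFourierTransform.transformsGaussians_inv
    (hU : W.IsQuadraticFourierTransform m U) : TransformsGaussians U⁻¹ W.freeSymplectic⁻¹ := by
  intro M hM b
  obtain ⟨N, a, hN, rfl, rfl⟩ := W.exists_preimage hM b
  obtain ⟨c, hc0, hc⟩ := hU.apply_gaussian hN a
  refine ⟨N, hN, a, c⁻¹, ?_, ?_⟩
  · exact (W.siegelRel_siegelImage hN).of_mul_eq_one W.freeMatrix_mem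
      (congrArg Subtype.val (inv_mul_cancel W.freeSymplectic)) hN hM
  · change U.symm _ = _
    rw [LinearIsometryEquiv.symm_apply_eq, map_smul, hc, smul_smul, inv_mul_cancel₀ hc0, one_smul]

theorem IsProjection.transformsGaussians (h : IsProjection U S) : TransformsGaussians U S := by
  refine (Subgroup.closure_induction (p := fun p _ => TransformsGaussians p.1 p.2 ∧
    TransformsGaussians p.1⁻¹ p.2⁻¹) ?_ ?_ ?_ ?_ h).1
  · rintro ⟨U, S⟩ ⟨W, m, hW, rfl⟩
    exact ⟨hW.transformsGaussians, hW.transformsGaussians_inv⟩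
  · simpa using TransformsGaussians.one
  · rintro p q - - ⟨hp, hp'⟩ ⟨hq, hq'⟩
    refine ⟨hp.mul hq, ?_⟩
    rw [Prod.fst_mul, Prod.snd_mul, _root_.mul_inv_rev, _root_.mul_inv_rev]
    exact hq'.mul hp'
  · rintro p - ⟨hp, hp'⟩
    exact ⟨hp', by simpa using hp⟩

theorem IsProjection.norm_inner_gaussian_pow_four_mul_det_le (h : IsProjection U S)
    (b d : Fin n → ℂ) :
    ‖inner ℂ ((gaussianSchwartz .one d).toLp 2 volume)
        (U ((gaussianSchwartz .one b).toLp 2 volume))‖ ^ 4 * (1 + S.1ᵀ * S.1).det ≤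
      4 ^ n * ‖(gaussianSchwartz .one b).toLp 2 volume‖ ^ 4 *
        ‖(gaussianSchwartz .one d).toLp 2 volume‖ ^ 4 := by
  obtain ⟨M, hM, b', c, hrel, hc⟩ := h.transformsGaussians 1 .one b
  have hle := norm_inner_gaussianSchwartz_pow_four_le hM .one b' d
  have hone : (1 : Matrix (Fin n) (Fin n) ℂ).map (starRingEnd ℂ) = 1 := by simp
  rw [hone, ← hrel.det_rePart_mul S.2 hM.symm, rePart_one, det_one, Fintype.card_fin] at hle
  have hnorm : ‖(gaussianSchwartz .one b).toLp 2 volume‖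
      = ‖c‖ * ‖(gaussianSchwartz hM b').toLp 2 volume‖ := by
    rw [← norm_smul, ← hc, U.norm_map]
  rw [hc, inner_smul_right, norm_mul, hnorm]
  refine le_of_mul_le_mul_left ?_ hM.posDef_rePart.det_pos
  linear_combination ‖c‖ ^ 4 * hle

end TransformsGaussians

section SingularValues

theorem det_one_add_adjoint_comp_self {𝕜 V V' : Type*} [RCLike 𝕜] [NormedAddCommGroup V]
    [InnerProductSpace 𝕜 V] [FiniteDimensional 𝕜 V] [NormedAddCommGroup V']
    [InnerProductSpace 𝕜 V'] [FiniteDimensional 𝕜 V'] (T : V →ₗ[𝕜] V') {m : ℕ}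
    (hm : Module.finrank 𝕜 V = m) :
    LinearMap.det (1 + T.adjoint ∘ₗ T) = ∏ i : Fin m, (1 + (T.singularValues i : 𝕜) ^ 2) := by
  have hsymm := T.isPositive_adjoint_comp_self.isSymmetric
  have hneg : LinearMap.det (-1 - T.adjoint ∘ₗ T)
      = ∏ i, (-1 - (hsymm.eigenvalues hm i : 𝕜)) := by
    have := LinearMap.eval_charpoly (T.adjoint ∘ₗ T) (-1 : 𝕜)
    rw [hsymm.charpoly_eq hm, Polynomial.eval_prod] at this
    simpa using this.symm
  have hsign : (1 + T.adjoint ∘ₗ T) = (-1 : 𝕜) • (-1 - T.adjoint ∘ₗ T) := by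
    rw [neg_one_smul]; abel
  rw [hsign, LinearMap.det_smul, hneg, hm, ← Fin.prod_const, ← Finset.prod_mul_distrib]
  refine Finset.prod_congr rfl fun i _ => ?_
  rw [← RCLike.ofReal_pow, T.sq_singularValues_fin hm]
  ring

theorem det_one_add_transpose_mul_self {ι : Type*} [Fintype ι] [DecidableEq ι] {m : ℕ}
    (hm : Fintype.card ι = m) (A : Matrix ι ι ℝ) :
    (1 + Aᵀ * A).det = ∏ i : Fin m, (1 + (toEuclideanLin A).singularValues i ^ 2) := by
  have hlin : toEuclideanLin (1 + Aᵀ * A)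
      = 1 + (toEuclideanLin A).adjoint ∘ₗ toEuclideanLin A := by
    rw [← toEuclideanLin_conjTranspose_eq_adjoint, conjTranspose_eq_transpose_of_trivial]
    ext x i
    simp [toLpLin_apply, mulVec_mulVec]
  rw [← LinearMap.det_toLpLin 2, hlin, det_one_add_adjoint_comp_self _ (by simpa using hm)]
  rfl

variable {n : ℕ}

theorem singularValue_pos (S : Sp n) {i : ℕ} (hi : i < n) : 0 < singularValue S i := by
  have hinj : Function.Injective (toEuclideanLin S.1) := fun x y hxy => by
    have hdet := SymplecticGroup.symplectic_det S.2
    exact WithLp.ofLp_injective 2 <|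
      mulVec_injective_of_isUnit ((isUnit_iff_isUnit_det _).mpr hdet) (congrArg WithLp.ofLp hxy)
  refine (LinearMap.injective_iff_forall_lt_finrank_singularValues_pos _).mp hinj i ?_
  simp only [finrank_euclideanSpace, Fintype.card_sum, Fintype.card_fin]
  omega

theorem prod_singularValue_sq_le (S : Sp n) :
    (∏ i ∈ Finset.range n, singularValue S i) ^ 2 ≤ (1 + S.1ᵀ * S.1).det := by
  rw [det_one_add_transpose_mul_self (m := n + n) (by simp), Fin.prod_univ_add, ← Finset.prod_pow,
    ← Fin.prod_univ_eq_prod_range (fun i => singularValue S i ^ 2)]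
  have hone (i : ℕ) : 1 ≤ 1 + (toEuclideanLin S.1).singularValues i ^ 2 :=
    le_add_of_nonneg_right (sq_nonneg _)
  calc ∏ i : Fin n, singularValue S i ^ 2
      ≤ ∏ i : Fin n, (1 + singularValue S (Fin.castAdd n i) ^ 2) :=
        Finset.prod_le_prod (fun i _ => sq_nonneg _) fun i _ => by simp
    _ ≤ _ := le_mul_of_one_le_right (Finset.prod_nonneg fun i _ => zero_le_one.trans (hone _))
        (Finset.one_le_prod fun i _ => hone _)

theorem IsProjection.norm_inner_gaussian_le {U : L2 n ≃ₗᵢ[ℂ] L2 n} {S : Sp n}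
    (h : IsProjection U S) (b d : Fin n → ℂ) :
    ‖inner ℂ ((gaussianSchwartz .one d).toLp 2 volume)
        (U ((gaussianSchwartz .one b).toLp 2 volume))‖ ≤
      2 ^ n * (∏ i ∈ Finset.range n, singularValue S i) ^ (-(1 / 2) : ℝ) *
        ‖(gaussianSchwartz .one b).toLp 2 volume‖ * ‖(gaussianSchwartz .one d).toLp 2 volume‖ := by
  have hfour := h.norm_inner_gaussian_pow_four_mul_det_le b d
  have hsq := prod_singularValue_sq_le S
  have hp : 0 < ∏ i ∈ Finset.range n, singularValue S i :=
    Finset.prod_pos fun _ hi => singularValue_pos S (Finset.mem_range.mp hi)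
  set p := ∏ i ∈ Finset.range n, singularValue S i
  set a := ‖inner ℂ ((gaussianSchwartz .one d).toLp 2 volume)
    (U ((gaussianSchwartz .one b).toLp 2 volume))‖
  have hpow : (p ^ (-(1 / 2) : ℝ)) ^ 4 = (p ^ 2)⁻¹ := by
    rw [← Real.rpow_natCast, ← Real.rpow_mul hp.le, ← Real.rpow_natCast, ← Real.rpow_neg hp.le]
    norm_num
  have hconst : (4 : ℝ) ^ n ≤ (2 ^ n) ^ 4 := by
    rw [← pow_mul, mul_comm, pow_mul]
    exact pow_le_pow_left₀ (by norm_num) (by norm_num) n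
  refine le_of_pow_le_pow_left₀ (n := 4) (by norm_num) (by positivity) ?_
  rw [mul_pow, mul_pow, mul_pow, hpow, mul_right_comm _ (p ^ 2)⁻¹, mul_right_comm _ (p ^ 2)⁻¹,
    le_mul_inv_iff₀ (by positivity)]
  calc a ^ 4 * p ^ 2 ≤ a ^ 4 * (1 + S.1ᵀ * S.1).det := by gcongr
    _ ≤ _ := hfour
    _ ≤ _ := by gcongr

end SingularValues

section ShortTimeFourierTransform

theorem hasTemperateGrowth_modulation {V : Type*} [NormedAddCommGroup V] [InnerProductSpace ℝ V]
    (ξ : V) :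
    (fun y : V => Complex.exp (Complex.I * ((inner ℝ ξ y : ℝ) : ℂ))).HasTemperateGrowth :=
  hasTemperateGrowth_cexp_comp (by fun_prop) fun y => by simp

variable {n : ℕ}

/-- The time-frequency shift `φ_z` of a Schwartz function `φ`, as a Schwartz function. -/
def wavePacket (φ : 𝓢(E n, ℂ)) (z : E n × E n) : 𝓢(E n, ℂ) :=
  SchwartzMap.smulLeftCLM ℂ (fun y => Complex.exp (Complex.I * ((inner ℝ z.2 y : ℝ) : ℂ)))
    (SchwartzMap.compSubConstCLM ℂ z.1 φ)

@[simp] theorem coe_wavePacket (φ : 𝓢(E n, ℂ)) (z : E n × E n) :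
    ⇑(wavePacket φ z) = timeFrequencyShift φ z := by
  ext y
  simp [wavePacket, timeFrequencyShift, hasTemperateGrowth_modulation]

theorem norm_timeFrequencyShift (φ : E n → ℂ) (z : E n × E n) (y : E n) :
    ‖timeFrequencyShift φ z y‖ = ‖φ (y - z.1)‖ := by
  simp [timeFrequencyShift, Complex.norm_exp]

theorem norm_toLp_wavePacket (φ : 𝓢(E n, ℂ)) (z : E n × E n) :
    ‖(wavePacket φ z).toLp 2 volume‖ = ‖φ.toLp 2 volume‖ := by
  have hnorm : eLpNorm (timeFrequencyShift φ z) 2 volume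
      = eLpNorm (fun y => φ (y - z.1)) 2 volume :=
    eLpNorm_congr_norm_ae (.of_forall (norm_timeFrequencyShift φ z))
  have htranslate : eLpNorm (fun y => φ (y - z.1)) 2 volume = eLpNorm φ 2 volume :=
    eLpNorm_comp_measurePreserving φ.continuous.aestronglyMeasurable
      (measurePreserving_sub_right volume z.1)
  rw [SchwartzMap.norm_toLp, SchwartzMap.norm_toLp, coe_wavePacket, hnorm, htranslate]

/-- The short-time Fourier transform `z ↦ ⟨f, φ_z⟩` of `f` with window `φ`. -/
def stft (φ f : E n → ℂ) (z : E n × E n) : ℂ :=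
  ∫ y, f y * conj (timeFrequencyShift φ z y)

theorem modulationNorm_eq_eLpNorm_stft (φ : 𝓢(E n, ℂ)) (p : ℝ≥0∞) (f : E n → ℂ) :
    modulationNorm φ p f = eLpNorm (stft φ f) p volume := rfl

theorem stft_coe_eq_inner (φ : 𝓢(E n, ℂ)) (u : L2 n) (z : E n × E n) :
    stft φ u z = inner ℂ ((wavePacket φ z).toLp 2 volume) u := by
  rw [L2.inner_def]
  refine integral_congr_ae ?_
  filter_upwards [(wavePacket φ z).coeFn_toLp 2 volume] with y hy
  rw [RCLike.inner_apply, hy, coe_wavePacket]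

theorem aestronglyMeasurable_stft (φ f : 𝓢(E n, ℂ)) : AEStronglyMeasurable (stft φ f) := by
  have hcont : Continuous fun p : (E n × E n) × E n =>
      f p.2 * conj (timeFrequencyShift φ p.1 p.2) := by
    have := f.continuous
    have := φ.continuous
    unfold timeFrequencyShift
    fun_prop
  exact hcont.stronglyMeasurable.integral_prod_right'.aestronglyMeasurable

open scoped FourierTransform

theorem stft_eq_fourier (φ f : E n → ℂ) (x ξ : E n) :
    stft φ f (x, ξ) = 𝓕 (fun y => f y * conj (φ (y - x))) ((2 * Real.pi)⁻¹ • ξ) := by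
  have hpi : (Real.pi : ℂ) ≠ 0 := mod_cast Real.pi_ne_zero
  rw [Real.fourier_eq']
  refine integral_congr_ae (.of_forall fun y => ?_)
  simp only [timeFrequencyShift, map_mul, ← Complex.exp_conj, Complex.conj_I, Complex.conj_ofReal,
    smul_eq_mul, real_inner_smul_right, real_inner_comm y ξ]
  rw [mul_left_comm]
  congr 2
  push_cast
  field_simp

/-- The product of `f` with the complex conjugate of the translate by `x` of the window `φ`, whose
Fourier transform is a slice of the short-time Fourier transform. -/
def windowed (f φ : 𝓢(E n, ℂ)) (x : E n) : 𝓢(E n, ℂ) :=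
  SchwartzMap.pairing (ContinuousLinearMap.mul ℂ ℂ) f
    (SchwartzMap.compSubConstCLM ℝ x
      (SchwartzMap.postcompCLM (Complex.conjCLE : ℂ →L[ℝ] ℂ) φ))

@[simp] theorem coe_windowed (f φ : 𝓢(E n, ℂ)) (x : E n) :
    ⇑(windowed f φ x) = fun y => f y * conj (φ (y - x)) := by
  ext y
  simp [windowed, SchwartzMap.pairing_apply_apply]

theorem stft_eq_fourier_windowed (φ f : 𝓢(E n, ℂ)) (x ξ : E n) :
    stft φ f (x, ξ) = 𝓕 (windowed f φ x) ((2 * Real.pi)⁻¹ • ξ) := by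
  rw [stft_eq_fourier, SchwartzMap.fourier_coe, coe_windowed]

theorem integral_fourier_mul_conj_fourier {V : Type*} [NormedAddCommGroup V]
    [InnerProductSpace ℝ V] [FiniteDimensional ℝ V] [MeasurableSpace V] [BorelSpace V]
    (F : 𝓢(V, ℂ)) {K : V → ℂ} (hK : Integrable K) :
    ∫ η, 𝓕 (F : V → ℂ) η * conj (𝓕 K η) = ∫ y, F y * conj (K y) := by
  have hinv (y : V) : VectorFourier.fourierIntegral Real.fourierChar volume
      (-(innerₗ V).flip) ((𝓕 F : 𝓢(V, ℂ)) : V → ℂ) y = F y := by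
    have hF : 𝓕⁻ (𝓕 F) = F := FourierTransform.fourierInv_fourier_eq F
    conv_rhs => rw [← hF, SchwartzMap.fourierInv_coe]
    rw [flip_innerₗ]
    rfl
  have hparseval := VectorFourier.integral_sesq_fourierIntegral_eq_neg_flip (innerSL ℂ (E := ℂ))
    (L := innerₗ V) Real.continuous_fourierChar continuous_inner hK
    ((𝓕 F : 𝓢(V, ℂ)).integrable (μ := volume))
  simp only [hinv] at hparseval
  exact hparseval

theorem integral_stft_mul_conj_stft (φ f : 𝓢(E n, ℂ)) (k : L2 n) (x : E n) :
    ∫ ξ, stft φ f (x, ξ) * conj (stft φ k (x, ξ))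
      = ((2 * Real.pi) ^ n : ℝ) * ∫ y, (f y * conj (k y)) * (φ (y - x) * conj (φ (y - x))) := by
  have hwindow : MemLp (fun y => conj (φ (y - x))) 2 :=
    (SchwartzMap.compSubConstCLM ℝ x φ).memLp 2 volume |>.star
  have hk : Integrable fun y => k y * conj (φ (y - x)) := (Lp.memLp k).integrable_mul hwindow
  simp only [stft_eq_fourier]
  rw [Measure.integral_comp_inv_smul volume (fun η =>
      𝓕 (fun y => f y * conj (φ (y - x))) η * conj (𝓕 (fun y => k y * conj (φ (y - x))) η)),
    ← coe_windowed, integral_fourier_mul_conj_fourier _ hk, finrank_euclideanSpace,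
    Fintype.card_fin, abs_of_pos (by positivity), Complex.real_smul, coe_windowed]
  congr 2 with y
  simp only [map_mul, Complex.conj_conj]
  ring

open scoped Convolution in
theorem integral_integral_stft_mul_conj_stft (φ f : 𝓢(E n, ℂ)) (k : L2 n) :
    ∫ x, ∫ ξ, stft φ f (x, ξ) * conj (stft φ k (x, ξ))
      = ((2 * Real.pi) ^ n * ‖φ.toLp 2 volume‖ ^ 2 : ℝ) * inner ℂ k (f.toLp 2 volume) := by
  set A : E n → ℂ := fun y => f y * conj (k y)
  set D : E n → ℂ := fun t => φ (-t) * conj (φ (-t))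
  have hA : Integrable A := (f.memLp 2 volume).integrable_mul (Lp.memLp k).star
  have hD : Integrable D :=
    ((φ.memLp 2 volume).integrable_mul (φ.memLp 2 volume).star).comp_neg
  have hAint : ∫ y, A y = inner ℂ k (f.toLp 2 volume) := by
    rw [L2.inner_def]
    refine integral_congr_ae ?_
    filter_upwards [f.coeFn_toLp 2 volume] with y hy
    rw [RCLike.inner_apply, hy]
  have hDint : ∫ t, D t = (‖φ.toLp 2 volume‖ ^ 2 : ℝ) := by
    rw [integral_neg_eq_self fun t => φ t * conj (φ t), Complex.ofReal_pow]
    exact (SchwartzMap.inner_toL2_toL2_eq φ φ volume).symm.trans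
      (inner_self_eq_norm_sq_to_K (𝕜 := ℂ) _)
  have hconv : ∫ x, ∫ y, A y * D (x - y) = (∫ y, A y) * ∫ t, D t :=
    integral_convolution (ContinuousLinearMap.mul ℂ ℂ) hA hD
  simp only [D, neg_sub] at hconv
  simp only [integral_stft_mul_conj_stft]
  rw [integral_const_mul, hconv, hAint, hDint]
  push_cast
  ring

/-- The constant `κ` in the resolution of the identity `∫ ⟨f, φ_z⟩ φ_z dz = κ f`, as an extended
nonnegative real. -/
def resolutionConstant (φ : 𝓢(E n, ℂ)) : ℝ≥0∞ :=
  ENNReal.ofReal ((2 * Real.pi) ^ n * ‖φ.toLp 2 volume‖ ^ 2)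

theorem resolutionConstant_ne_top (φ : 𝓢(E n, ℂ)) : resolutionConstant φ ≠ ∞ :=
  ENNReal.ofReal_ne_top

theorem resolutionConstant_ne_zero {φ : 𝓢(E n, ℂ)} (hφ : φ.toLp 2 volume ≠ 0) :
    resolutionConstant φ ≠ 0 := by
  have := norm_pos_iff.mpr hφ
  exact (ENNReal.ofReal_pos.mpr (by positivity)).ne'

/-- Duality of `M¹` and `M^∞`, by pairing the resolution of the identity with `k`. -/
theorem enorm_inner_le_modulationNorm_one {φ : 𝓢(E n, ℂ)} (hφ : φ.toLp 2 volume ≠ 0)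
    (f : 𝓢(E n, ℂ)) (k : L2 n) {B : ℝ≥0∞}
    (hB : ∀ z, ‖inner ℂ ((wavePacket φ z).toLp 2 volume) k‖ₑ ≤ B) :
    ‖inner ℂ k (f.toLp 2 volume)‖ₑ ≤ B * modulationNorm φ 1 f / resolutionConstant φ := by
  have hmeas := (aestronglyMeasurable_stft φ f).enorm
  have hconst : resolutionConstant φ
      = ‖(((2 * Real.pi) ^ n * ‖φ.toLp 2 volume‖ ^ 2 : ℝ) : ℂ)‖ₑ := by
    rw [resolutionConstant, ← ofReal_norm, Complex.norm_real, Real.norm_of_nonneg (by positivity)]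
  rw [ENNReal.le_div_iff_mul_le (.inl (resolutionConstant_ne_zero hφ))
    (.inl (resolutionConstant_ne_top φ)), mul_comm]
  calc _ = ‖∫ x, ∫ ξ, stft φ f (x, ξ) * conj (stft φ k (x, ξ))‖ₑ := by
        rw [integral_integral_stft_mul_conj_stft, enorm_mul, hconst]
    _ ≤ ∫⁻ x, ∫⁻ ξ, ‖stft φ f (x, ξ) * conj (stft φ k (x, ξ))‖ₑ :=
        (enorm_integral_le_lintegral_enorm _).trans
          (lintegral_mono fun x => enorm_integral_le_lintegral_enorm _)
    _ ≤ ∫⁻ x, ∫⁻ ξ, B * ‖stft φ f (x, ξ)‖ₑ := by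
        gcongr with x ξ
        rw [enorm_mul, mul_comm, RCLike.enorm_conj, stft_coe_eq_inner]
        gcongr
        exact hB _
    _ = B * modulationNorm φ 1 f := by
        rw [modulationNorm_eq_eLpNorm_stft, eLpNorm_one_eq_lintegral_enorm,
          ← lintegral_const_mul'' _ hmeas, Measure.volume_eq_prod,
          lintegral_prod _ (hmeas.const_mul _)]

end ShortTimeFourierTransform

section ModulationSpace

variable {n : ℕ}

theorem one_add_norm_le_mul {V : Type*} [SeminormedAddCommGroup V] (x y : V) :
    1 + ‖x‖ ≤ (1 + ‖y‖) * (1 + ‖y - x‖) := by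
  have htriangle : ‖x‖ ≤ ‖y‖ + ‖y - x‖ := by simpa using norm_sub_le y (y - x)
  nlinarith [mul_nonneg (norm_nonneg y) (norm_nonneg (y - x))]

theorem exists_one_add_norm_pow_mul_iteratedFDeriv_le {V F : Type*}
    [NormedAddCommGroup V] [NormedSpace ℝ V] [NormedAddCommGroup F] [NormedSpace ℝ F]
    (f : 𝓢(V, F)) (k l : ℕ) :
    ∃ C, 0 ≤ C ∧ ∀ i ≤ l, ∀ y, (1 + ‖y‖) ^ k * ‖iteratedFDeriv ℝ i f y‖ ≤ C := by
  have hbound : ∀ i ≤ l, ∀ y, (1 + ‖y‖) ^ k * ‖iteratedFDeriv ℝ i f y‖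
      ≤ 2 ^ k * (Finset.Iic (k, l)).sup (fun p => SchwartzMap.seminorm ℝ p.1 p.2) f :=
    fun i hi y => SchwartzMap.one_add_le_sup_seminorm_apply (𝕜 := ℝ) (m := (k, l)) le_rfl hi f y
  exact ⟨_, le_trans (by positivity) (hbound 0 (Nat.zero_le _) 0), hbound⟩

theorem norm_iteratedFDeriv_windowed_le (f φ : 𝓢(E n, ℂ)) (x y : E n) (l : ℕ) :
    ‖iteratedFDeriv ℝ l (windowed f φ x) y‖ ≤ ∑ i ∈ Finset.range (l + 1),
      (l.choose i : ℝ) * ‖iteratedFDeriv ℝ i f y‖ * ‖iteratedFDeriv ℝ (l - i) φ (y - x)‖ := by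
  have hconj (j : ℕ) : ‖iteratedFDeriv ℝ j (fun y => conj (φ (y - x))) y‖
      = ‖iteratedFDeriv ℝ j φ (y - x)‖ := by
    rw [← iteratedFDeriv_comp_sub j x y]
    exact Complex.conjLIE.norm_iteratedFDeriv_comp_left (fun y => φ (y - x)) y j
  have hsmooth : ContDiff ℝ l fun y => conj (φ (y - x)) :=
    Complex.conjCLE.contDiff.comp ((φ.smooth l).comp (contDiff_id.sub contDiff_const))
  simp only [← hconj, coe_windowed]
  exact norm_iteratedFDeriv_mul_le (f.smooth l) hsmooth y le_rfl

theorem exists_seminorm_windowed_le (f φ : 𝓢(E n, ℂ)) (m k l : ℕ) :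
    ∃ C : ℝ, 0 ≤ C ∧ ∀ x, (1 + ‖x‖) ^ m * SchwartzMap.seminorm ℝ k l (windowed f φ x) ≤ C := by
  obtain ⟨A, hA, hfA⟩ := exists_one_add_norm_pow_mul_iteratedFDeriv_le f (k + m) l
  obtain ⟨D, hD, hφD⟩ := exists_one_add_norm_pow_mul_iteratedFDeriv_le φ m l
  set C := ∑ i ∈ Finset.range (l + 1), (l.choose i : ℝ) * A * D
  have hC : 0 ≤ C := Finset.sum_nonneg fun i _ => by positivity
  refine ⟨C, hC, fun x => ?_⟩
  have hx : 0 < (1 + ‖x‖) ^ m := by positivity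
  rw [← le_div_iff₀' hx]
  refine SchwartzMap.seminorm_le_bound ℝ k l _ (by positivity) fun y => ?_
  rw [le_div_iff₀' hx]
  calc (1 + ‖x‖) ^ m * (‖y‖ ^ k * ‖iteratedFDeriv ℝ l (windowed f φ x) y‖)
      ≤ ((1 + ‖y‖) * (1 + ‖y - x‖)) ^ m * ((1 + ‖y‖) ^ k * ∑ i ∈ Finset.range (l + 1),
          (l.choose i : ℝ) * ‖iteratedFDeriv ℝ i f y‖ *
            ‖iteratedFDeriv ℝ (l - i) φ (y - x)‖) := by
        gcongr
        · exact one_add_norm_le_mul x y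
        · linarith
        · exact norm_iteratedFDeriv_windowed_le f φ x y l
    _ = ∑ i ∈ Finset.range (l + 1), (l.choose i : ℝ) *
          ((1 + ‖y‖) ^ (k + m) * ‖iteratedFDeriv ℝ i f y‖) *
          ((1 + ‖y - x‖) ^ m * ‖iteratedFDeriv ℝ (l - i) φ (y - x)‖) := by
        rw [Finset.mul_sum, Finset.mul_sum]
        refine Finset.sum_congr rfl fun i _ => ?_
        rw [mul_pow, pow_add]
        ring
    _ ≤ C := by
        refine Finset.sum_le_sum fun i hi => ?_
        gcongr
        · exact hfA i (Nat.lt_succ_iff.mp (Finset.mem_range.mp hi)) y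
        · exact hφD (l - i) (Nat.sub_le l i) (y - x)

theorem exists_norm_clm_windowed_le {V : Type*} [NormedAddCommGroup V] [NormedSpace ℝ V]
    (T : 𝓢(E n, ℂ) →L[ℝ] V) (f φ : 𝓢(E n, ℂ)) (m : ℕ) :
    ∃ C : ℝ, ∀ x, ‖T (windowed f φ x)‖ ≤ C * ((1 + ‖x‖) ^ m)⁻¹ := by
  obtain ⟨s, A, -, hT⟩ := Seminorm.bound_of_continuous (schwartz_withSeminorms ℝ (E n) ℂ)
    ((normSeminorm ℝ V).comp T.toLinearMap) (continuous_norm.comp T.continuous)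
  choose D hD hwindowed using fun p : ℕ × ℕ => exists_seminorm_windowed_le f φ m p.1 p.2
  have hsum : 0 ≤ ∑ p ∈ s, D p := Finset.sum_nonneg fun p _ => hD p
  refine ⟨A * ∑ p ∈ s, D p, fun x => ?_⟩
  have hsup : (s.sup (schwartzSeminormFamily ℝ (E n) ℂ)) (windowed f φ x)
      ≤ (∑ p ∈ s, D p) * ((1 + ‖x‖) ^ m)⁻¹ := by
    refine Seminorm.finset_sup_apply_le (by positivity) fun p hp => ?_
    rw [le_mul_inv_iff₀' (by positivity)]
    exact (hwindowed p x).trans (Finset.single_le_sum (fun p _ => hD p) hp)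
  calc ‖T (windowed f φ x)‖ ≤ A * s.sup (schwartzSeminormFamily ℝ (E n) ℂ) (windowed f φ x) :=
        hT (windowed f φ x)
    _ ≤ A * ((∑ p ∈ s, D p) * ((1 + ‖x‖) ^ m)⁻¹) := by gcongr
    _ = _ := by ring

open scoped FourierTransform in
theorem integral_norm_stft (φ f : 𝓢(E n, ℂ)) (x : E n) :
    ∫ ξ, ‖stft φ f (x, ξ)‖ = (2 * Real.pi) ^ n * ‖(𝓕 (windowed f φ x)).toLp 1 volume‖ := by
  simp only [stft_eq_fourier_windowed]
  rw [Measure.integral_comp_inv_smul volume fun η => ‖𝓕 (windowed f φ x) η‖,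
    SchwartzMap.norm_toLp_one, finrank_euclideanSpace, Fintype.card_fin, smul_eq_mul,
    abs_of_pos (by positivity)]

theorem integrable_inv_one_add_norm_pow :
    Integrable fun x : E n => ((1 + ‖x‖) ^ (n + 1))⁻¹ := by
  have h : Integrable fun x : E n => (1 + ‖x‖) ^ (-((n + 1 : ℕ) : ℝ)) :=
    integrable_one_add_norm (by simp)
  refine h.congr (.of_forall fun x => ?_)
  simp only
  rw [Real.rpow_neg (by positivity), Real.rpow_natCast]

open scoped FourierTransform in
theorem modulationNorm_one_lt_top (φ f : 𝓢(E n, ℂ)) : modulationNorm φ 1 f < ∞ := by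
  have hmeas := aestronglyMeasurable_stft φ f
  have hslice (x : E n) : Integrable fun ξ => stft φ f (x, ξ) := by
    simp only [stft_eq_fourier_windowed]
    exact (𝓕 (windowed f φ x)).integrable.comp_smul (by positivity)
  obtain ⟨C, hC⟩ := exists_norm_clm_windowed_le
    (SchwartzMap.toLpCLM ℝ ℂ 1 volume ∘L SchwartzMap.fourierTransformCLM ℝ) f φ (n + 1)
  rw [Measure.volume_eq_prod] at hmeas
  have hint : Integrable (stft φ f) (volume.prod volume) := by
    refine (integrable_prod_iff hmeas).mpr ⟨.of_forall hslice,
      ((integrable_inv_one_add_norm_pow.const_mul C).const_mul ((2 * Real.pi) ^ n)).mono'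
        hmeas.norm.integral_prod_right' (.of_forall fun x => ?_)⟩
    rw [integral_norm_stft, Real.norm_of_nonneg (by positivity)]
    gcongr
    exact hC x
  exact (memLp_one_iff_integrable.mpr hint).2

theorem norm_stft_timeFrequencyShift (φ f : E n → ℂ) (w z : E n × E n) :
    ‖stft φ (timeFrequencyShift f w) z‖ = ‖stft φ f (z - w)‖ := by
  have hphase (y : E n) : timeFrequencyShift f w (y + w.1) *
      conj (timeFrequencyShift φ z (y + w.1))
      = Complex.exp (((inner ℝ (w.2 - z.2) w.1 : ℝ) : ℂ) * Complex.I) *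
        (f y * conj (timeFrequencyShift φ (z - w) y)) := by
    have hexp : Complex.exp (Complex.I * ((inner ℝ w.2 (y + w.1) : ℝ) : ℂ)) *
        Complex.exp (-Complex.I * ((inner ℝ z.2 (y + w.1) : ℝ) : ℂ))
        = Complex.exp (((inner ℝ (w.2 - z.2) w.1 : ℝ) : ℂ) * Complex.I) *
          Complex.exp (-Complex.I * ((inner ℝ (z.2 - w.2) y : ℝ) : ℂ)) := by
      rw [← Complex.exp_add, ← Complex.exp_add]
      simp only [inner_add_right, inner_sub_left]
      congr 1
      push_cast
      ring
    simp only [timeFrequencyShift, Prod.fst_sub, Prod.snd_sub, map_mul, ← Complex.exp_conj,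
      Complex.conj_I, Complex.conj_ofReal, add_sub_cancel_right]
    rw [show y + w.1 - z.1 = y - (z.1 - w.1) by abel]
    linear_combination (f y * conj (φ (y - (z.1 - w.1)))) * hexp
  rw [stft, ← integral_add_right_eq_self _ w.1]
  simp only [hphase]
  rw [integral_const_mul, norm_mul, Complex.norm_exp_ofReal_mul_I, one_mul, stft]

theorem modulationNorm_wavePacket (φ f : 𝓢(E n, ℂ)) (p : ℝ≥0∞) (w : E n × E n) :
    modulationNorm φ p (wavePacket f w) = modulationNorm φ p f := by
  rw [modulationNorm_eq_eLpNorm_stft, modulationNorm_eq_eLpNorm_stft, coe_wavePacket,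
    eLpNorm_congr_norm_ae (.of_forall (norm_stft_timeFrequencyShift φ f w))]
  exact eLpNorm_comp_measurePreserving (aestronglyMeasurable_stft φ f)
    ((measurePreserving_sub_right volume w.1).prod (measurePreserving_sub_right volume w.2))

end ModulationSpace

section Dispersive

variable {n : ℕ}

section Operator

variable (T : L2 n →L[ℂ] L2 n) {φ : 𝓢(E n, ℂ)} {B : ℝ≥0∞}

theorem enorm_inner_apply_le_modulationNorm_one (hφ : φ.toLp 2 volume ≠ 0) (u : L2 n)
    (hT : ∀ z, ‖inner ℂ u (T ((wavePacket φ z).toLp 2 volume))‖ₑ ≤ B) (f : 𝓢(E n, ℂ)) :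
    ‖inner ℂ u (T (f.toLp 2 volume))‖ₑ ≤ B * modulationNorm φ 1 f / resolutionConstant φ := by
  rw [← ContinuousLinearMap.adjoint_inner_left]
  refine enorm_inner_le_modulationNorm_one hφ f _ fun z => ?_
  rw [ContinuousLinearMap.adjoint_inner_right, ← ofReal_norm, norm_inner_symm, ofReal_norm]
  exact hT z

theorem modulationNorm_top_apply_le (hφ : φ.toLp 2 volume ≠ 0)
    (hT : ∀ w z, ‖inner ℂ ((wavePacket φ w).toLp 2 volume)
      (T ((wavePacket φ z).toLp 2 volume))‖ₑ ≤ B) (f : 𝓢(E n, ℂ)) :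
    modulationNorm φ ∞ (T (f.toLp 2 volume))
      ≤ B * modulationNorm φ 1 f / resolutionConstant φ := by
  rw [modulationNorm_eq_eLpNorm_stft, eLpNorm_exponent_top]
  refine eLpNormEssSup_le_of_ae_enorm_bound (.of_forall fun w => ?_)
  rw [stft_coe_eq_inner]
  exact enorm_inner_apply_le_modulationNorm_one T hφ _ (hT w) f

theorem enorm_inner_wavePacket_apply_le_of_window (hφ : φ.toLp 2 volume ≠ 0)
    (hT : ∀ w z, ‖inner ℂ ((wavePacket φ w).toLp 2 volume)
      (T ((wavePacket φ z).toLp 2 volume))‖ₑ ≤ B) (f h : 𝓢(E n, ℂ)) (w z : E n × E n) :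
    ‖inner ℂ ((wavePacket h w).toLp 2 volume) (T ((wavePacket f z).toLp 2 volume))‖ₑ
      ≤ B * modulationNorm φ 1 h / resolutionConstant φ * modulationNorm φ 1 f
        / resolutionConstant φ := by
  rw [← modulationNorm_wavePacket φ f 1 z, ← modulationNorm_wavePacket φ h 1 w]
  refine enorm_inner_apply_le_modulationNorm_one T hφ _ (fun z' => ?_) _
  rw [← ofReal_norm, norm_inner_symm, ofReal_norm]
  exact enorm_inner_le_modulationNorm_one hφ _ _ fun w' => hT w' z'

end Operator

theorem exists_wavePacket_gaussianSchwartz {M : Matrix (Fin n) (Fin n) ℂ} (hM : IsSiegel M)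
    (b : Fin n → ℂ) (z : E n × E n) :
    ∃ (c : ℂ) (d : Fin n → ℂ),
      wavePacket (gaussianSchwartz hM b) z = c • gaussianSchwartz hM d := by
  set p := vecC z.1.ofLp
  refine ⟨Complex.exp (-(1 / 2) * (p ⬝ᵥ M *ᵥ p) - b ⬝ᵥ p),
    b + M *ᵥ p + Complex.I • vecC z.2.ofLp, ?_⟩
  ext y
  have hinner : ((inner ℝ z.2 y : ℝ) : ℂ) = vecC z.2.ofLp ⬝ᵥ vecC y.ofLp := by
    rw [EuclideanSpace.inner_eq_star_dotProduct, star_trivial, vecC_dotProduct, dotProduct_comm]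
  have hsub : vecC (y - z.1).ofLp = vecC y.ofLp - p := by
    ext i; simp [p]
  have hsymm : (M *ᵥ p) ⬝ᵥ vecC y.ofLp = p ⬝ᵥ M *ᵥ vecC y.ofLp := by
    rw [dotProduct_mulVec, ← mulVec_transpose, hM.symm]
  rw [coe_wavePacket, timeFrequencyShift, _root_.smul_apply, coe_gaussianSchwartz,
    coe_gaussianSchwartz, gaussian, gaussian, smul_eq_mul, ← Complex.exp_add, ← Complex.exp_add,
    hinner, hsub]
  congr 1
  simp only [mulVec_sub, dotProduct_sub, sub_dotProduct, add_dotProduct, smul_dotProduct,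
    smul_eq_mul, hsymm]
  rw [dotProduct_comm (vecC y.ofLp) (M *ᵥ p), hsymm]
  ring

theorem IsProjection.norm_inner_wavePacket_gaussian_le {U : L2 n ≃ₗᵢ[ℂ] L2 n} {S : Sp n}
    (h : IsProjection U S) (b : Fin n → ℂ) (w z : E n × E n) :
    ‖inner ℂ ((wavePacket (gaussianSchwartz .one b) w).toLp 2 volume)
        (U ((wavePacket (gaussianSchwartz .one b) z).toLp 2 volume))‖ ≤
      2 ^ n * ‖(gaussianSchwartz .one b).toLp 2 volume‖ ^ 2 *
        (∏ i ∈ Finset.range n, singularValue S i) ^ (-(1 / 2) : ℝ) := by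
  have hnorm_w := norm_toLp_wavePacket (gaussianSchwartz .one b) w
  have hnorm_z := norm_toLp_wavePacket (gaussianSchwartz .one b) z
  obtain ⟨c, d, hw⟩ := exists_wavePacket_gaussianSchwartz .one b w
  obtain ⟨c', d', hz⟩ := exists_wavePacket_gaussianSchwartz .one b z
  have hsmul (c : ℂ) (f : 𝓢(E n, ℂ)) : (c • f).toLp 2 volume = c • f.toLp 2 volume :=
    map_smul (SchwartzMap.toLpCLM ℂ ℂ 2 volume) c f
  rw [hw, hsmul, norm_smul] at hnorm_w
  rw [hz, hsmul, norm_smul] at hnorm_z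
  rw [hw, hz, hsmul, hsmul, map_smul, inner_smul_left, inner_smul_right, norm_mul, norm_mul,
    RCLike.norm_conj]
  calc _ ≤ ‖c‖ * (‖c'‖ * (2 ^ n * (∏ i ∈ Finset.range n, singularValue S i) ^ (-(1 / 2) : ℝ) *
          ‖(gaussianSchwartz .one d').toLp 2 volume‖ *
          ‖(gaussianSchwartz .one d).toLp 2 volume‖)) := by
        gcongr
        exact h.norm_inner_gaussian_le d' d
    _ = 2 ^ n * ((‖c‖ * ‖(gaussianSchwartz .one d).toLp 2 volume‖) *
          (‖c'‖ * ‖(gaussianSchwartz .one d').toLp 2 volume‖)) *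
          (∏ i ∈ Finset.range n, singularValue S i) ^ (-(1 / 2) : ℝ) := by ring
    _ = _ := by rw [hnorm_w, hnorm_z, sq]

theorem exists_modulationNorm_top_apply_le {φ : 𝓢(E n, ℂ)} (hφ : φ ≠ 0) :
    ∃ K : ℝ≥0∞, K ≠ ∞ ∧ ∀ {U : L2 n ≃ₗᵢ[ℂ] L2 n} {S : Sp n}, IsProjection U S →
      ∀ f : 𝓢(E n, ℂ), modulationNorm φ ∞ (U (f.toLp 2 volume)) ≤
        K * ENNReal.ofReal ((∏ i ∈ Finset.range n, singularValue S i) ^ (-(1 / 2) : ℝ)) *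
          modulationNorm φ 1 f := by
  have hφL2 : φ.toLp 2 volume ≠ 0 := by
    rw [← map_zero (SchwartzMap.toLpCLM ℂ ℂ 2 (volume : Measure (E n)))]
    exact (SchwartzMap.injective_toLp 2 volume).ne hφ
  set g : 𝓢(E n, ℂ) := gaussianSchwartz .one 0
  have hg : g.toLp 2 volume ≠ 0 := toLp_gaussianSchwartz_ne_zero .one 0
  refine ⟨ENNReal.ofReal (2 ^ n * ‖g.toLp 2 volume‖ ^ 2) * modulationNorm g 1 φ
      / resolutionConstant g * modulationNorm g 1 φ / resolutionConstant g
      / resolutionConstant φ, ?_, fun {U S} h f => ?_⟩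
  · have hκg := resolutionConstant_ne_zero hg
    have hκφ := resolutionConstant_ne_zero hφL2
    have hM := (modulationNorm_one_lt_top g φ).ne
    finiteness
  set P := ENNReal.ofReal ((∏ i ∈ Finset.range n, singularValue S i) ^ (-(1 / 2) : ℝ))
  have hgauss (w z : E n × E n) : ‖inner ℂ ((wavePacket g w).toLp 2 volume)
      (U ((wavePacket g z).toLp 2 volume))‖ₑ
      ≤ ENNReal.ofReal (2 ^ n * ‖g.toLp 2 volume‖ ^ 2) * P := by
    rw [← ofReal_norm, ← ENNReal.ofReal_mul (by positivity)]
    exact ENNReal.ofReal_le_ofReal (h.norm_inner_wavePacket_gaussian_le 0 w z)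
  have hwindow := enorm_inner_wavePacket_apply_le_of_window
    (U.toContinuousLinearEquiv : L2 n →L[ℂ] L2 n) hg hgauss φ φ
  refine (modulationNorm_top_apply_le _ hφL2 hwindow f).trans_eq ?_
  simp only [div_eq_mul_inv]
  ring

end Dispersive

end Metaplectic

end

theorem theorem1p1 (n : ℕ) (φ : 𝓢(Metaplectic.E n, ℂ)) (hφ : φ ≠ 0) :
    ∃ C : ℝ, 0 < C ∧
      ∀ Shat ∈ Metaplectic.Mp n, ∀ S : Metaplectic.Sp n, Metaplectic.IsProjection Shat S →
        ∀ ψ : 𝓢(Metaplectic.E n, ℂ),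
          Metaplectic.modulationNorm φ ∞ (Shat (ψ.toLp 2 volume)) ≤
            ENNReal.ofReal
              (C * (∏ i ∈ Finset.range n, Metaplectic.singularValue S i) ^ (-(1 / 2) : ℝ)) *
              Metaplectic.modulationNorm φ 1 ψ := by
  obtain ⟨K, hK, hle⟩ := Metaplectic.exists_modulationNorm_top_apply_le hφ
  refine ⟨K.toReal + 1, by positivity, fun Shat _ S hS ψ => (hle hS ψ).trans ?_⟩
  rw [ENNReal.ofReal_mul (by positivity)]
  gcongr
  exact (ENNReal.ofReal_toReal hK).symm.le.trans (ENNReal.ofReal_le_ofReal (by linarith))
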